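/- Let $d\ge 1$ and let $\Omega\subset\mathbb{R}^d$ be a (possibly non-convex) polytope of Lebesgue measure $1$, that is, a finite union of compact convex polytopes with non-empty interior. For a unit vector $\nu$, the faces of $\Omega$ with outward unit normal $\nu$ are the connected components of the set of all points $x$ such that, for some $r>0$, $\Omega\cap B_r(x)=\{y\in B_r(x):\langle \nu,y-x\rangle\le 0\}$. Suppose that there is a unit vector $\xi\in S^{d-1}$ such that $$\sum_i \sigma^*(\Omega_i)\neq 0,$$ where the finite sum is over all faces $\Omega_i$ of $\Omega$ that are orthogonal to $\xi$, and $\sigma^*(\Omega_i)=\sigma(\Omega_i)$ if the outward unit normal of $\Omega_i$ is $\xi$, $\sigma^*(\Omega_i)=-\sigma(\Omega_i)$ if it is $-\xi$; here $\sigma$ is the $(d-1)$-dimensional surface measure. Then $\Omega$ is not spectral: there is no set $\Lambda\subset\mathbb{R}^d$ for which the functions $e_\lambda(x)=\exp(2\pi i\langle\lambda,x\rangle)$, $\lambda\in\Lambda$, form an orthonormal basis of the Hilbert space $L^2(\Omega)$ with $\langle f,g\rangle_\Omega=\int_\Omega f\overline{g}$. -/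

import Mathlib

open scoped MeasureTheory

/-- A (full-dimensional, closed) convex polytope in `ℝ^d`: a bounded set with non-empty interior
which is the intersection of finitely many closed half-spaces `{x | ⟪a, x⟫ ≤ b}`. -/
def IsConvexPolytope {d : ℕ} (P : Set (EuclideanSpace ℝ (Fin d))) : Prop :=
  Bornology.IsBounded P ∧ (interior P).Nonempty ∧
    ∃ H : Finset (EuclideanSpace ℝ (Fin d) × ℝ), P = {x | ∀ h ∈ H, inner ℝ h.1 x ≤ h.2}

/-- A (possibly non-convex) polytope in `ℝ^d`: a finite union of full-dimensional convex
polytopes. -/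
def IsPolytope {d : ℕ} (Ω : Set (EuclideanSpace ℝ (Fin d))) : Prop :=
  ∃ C : Set (Set (EuclideanSpace ℝ (Fin d))),
    C.Finite ∧ (∀ P ∈ C, IsConvexPolytope P) ∧ Ω = ⋃₀ C

/-- The set of the points near which `Ω` coincides with the half-space through the point whose
outward normal vector is `ν`, that is, the flat boundary points of `Ω` at which the
outward unit normal vector is `ν` (for a unit vector `ν`). -/
def pointsWithNormal {d : ℕ} (Ω : Set (EuclideanSpace ℝ (Fin d)))
    (ν : EuclideanSpace ℝ (Fin d)) : Set (EuclideanSpace ℝ (Fin d)) :=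
  {x | ∃ r > 0, ∀ y ∈ Metric.ball x r, (y ∈ Ω ↔ inner ℝ ν (y - x) ≤ 0)}

/-- The (relatively open, `(d-1)`-dimensional) faces of `Ω` with outward unit normal vector `ν`:
the connected components of the set of the boundary points with outward unit normal `ν`.
Each is an open subset of a hyperplane orthogonal to `ν`. -/
def facesWithNormal {d : ℕ} (Ω : Set (EuclideanSpace ℝ (Fin d)))
    (ν : EuclideanSpace ℝ (Fin d)) : Set (Set (EuclideanSpace ℝ (Fin d))) :=
  {F | ∃ x ∈ pointsWithNormal Ω ν, F = connectedComponentIn (pointsWithNormal Ω ν) x}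

/-- The total surface measure of the faces of `Ω` with outward unit normal vector `ν`. The surface
measure is the `(d-1)`-dimensional Hausdorff measure normalized to agree with
`(d-1)`-dimensional Lebesgue measure on hyperplanes. -/
noncomputable def totalFaceArea {d : ℕ} (Ω : Set (EuclideanSpace ℝ (Fin d)))
    (ν : EuclideanSpace ℝ (Fin d)) : ENNReal :=
  ∑' F : facesWithNormal Ω ν, μHE[d - 1] (F : Set (EuclideanSpace ℝ (Fin d)))

/-- The signed total surface measure of the faces of `Ω` orthogonal to the unit vector `ξ`: a face
counts with the sign `+` if its outward unit normal is `ξ`, with the sign `-` if it is `-ξ`. -/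
noncomputable def signedFaceArea {d : ℕ} (Ω : Set (EuclideanSpace ℝ (Fin d)))
    (ξ : EuclideanSpace ℝ (Fin d)) : ℝ :=
  (totalFaceArea Ω ξ).toReal - (totalFaceArea Ω (-ξ)).toReal

/-- The exponential `e_l (x) = exp (2 π i ⟪l, x⟫)`. -/
noncomputable def expFun {d : ℕ} (l x : EuclideanSpace ℝ (Fin d)) : ℂ :=
  Complex.exp (2 * Real.pi * Complex.I * (inner ℝ l x : ℝ))

/-- `(Ω, Λ)` is a spectral pair: the (classes of the) exponentials `e_l`, `l ∈ Λ`, are an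
orthonormal (Hilbert) basis of `L²(Ω)`. -/
def IsSpectralPair {d : ℕ} (Ω Λ : Set (EuclideanSpace ℝ (Fin d))) : Prop :=
  ∃ b : HilbertBasis Λ ℂ (MeasureTheory.Lp ℂ 2 (MeasureTheory.volume.restrict Ω)),
    ∀ l : Λ, (b l : EuclideanSpace ℝ (Fin d) → ℂ) =ᵐ[MeasureTheory.volume.restrict Ω]
      expFun (l : EuclideanSpace ℝ (Fin d))

/-- `Ω` is spectral: it has a spectrum `Λ`. -/
def IsSpectral {d : ℕ} (Ω : Set (EuclideanSpace ℝ (Fin d))) : Prop :=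
  ∃ Λ : Set (EuclideanSpace ℝ (Fin d)), IsSpectralPair Ω Λ

/-!
Write `F η = ∫_Ω e_η`. If the exponentials `e_l`, `l ∈ Λ`, form an orthonormal basis of `L²(Ω)`,
then `F (l' - l) = 0` for distinct `l, l' ∈ Λ`, and Parseval's identity for `e_η` reads
`∑_{l ∈ Λ} |F (η - l)|² = 1` for every `η`.

The hypothesis on the faces produces many balls without zeros of `F`. Slice `ℝ^d` by the lines
parallel to `ξ`, so that a point is `ι y + s ξ` with `ι` an isometry onto the hyperplane orthogonal
to `ξ`. By inclusion-exclusion the indicator of `Ω` is a combination of indicators of convex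
polyhedra, each of which meets the line above `y` in an interval `[A y, B y]` whose end points are
piecewise affine in `y`. Integrating along the lines,
`2 π i τ F (ι v + τ ξ) = ∫ e (⟪v, y⟫) (e (τ B y) - e (τ A y)) dy` with `e u = exp (2 π i u)`.
This depends on `v` in a Lipschitz way, uniformly in `τ`. For `v = 0` the Riemann-Lebesgue lemma
kills, as `τ → ∞`, all but the parts where the end points are constant, and leaves
`∑_s J s e (τ s)`, a finite sum in which `J s` is the signed area of the faces orthogonal to `ξ` at
height `s` (`exists_jump_expansion`). Its value at `τ = 0` is the signed face area, which is not
zero. By recurrence of powers in a compact group there are arbitrarily large `m` such that the sum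
stays close to this value at `τ = m, 2 m, …, N m`. Hence, for some `δ` that does not depend on `N`,
`F` has no zero in the balls of radius `2 δ` around `j m ξ`, `0 ≤ j ≤ N`
(`exists_forall_expTransform_ne_zero`).

It follows that the balls of radius `δ` around the points `j m ξ - l`, `0 ≤ j ≤ N`, `l ∈ Λ`, are
pairwise disjoint. Integrating Parseval's identity over the balls `B (j m ξ, δ)` and summing over
`j` gives `(N + 1) |B_δ| ≤ ∫ |F|²`, and the right-hand side is `|Ω| = 1` by Plancherel's theorem.
This is absurd for large `N` (`not_isSpectralPair_of_expTransform_ne_zero`).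
-/

open MeasureTheory FourierTransform Filter
open scoped Topology

/-! ### Plancherel's identity for functions in `L¹ ∩ L²` -/

/-- On `L¹ ∩ L²` the Fourier transform given by the integral agrees with the one on `L²`: both
have the same pairing with every test function. -/
theorem fourier_toLp_ae_eq {E : Type*} [NormedAddCommGroup E] [InnerProductSpace ℝ E]
    [FiniteDimensional ℝ E] [MeasurableSpace E] [BorelSpace E] {f : E → ℂ}
    (hf : Integrable f) (hf2 : MemLp f 2) :
    (𝓕 (hf2.toLp f) : Lp (α := E) ℂ 2) =ᵐ[volume] 𝓕 f := by
  have hcont : Continuous (𝓕 f) :=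
    VectorFourier.fourierIntegral_continuous Real.continuous_fourierChar
      (innerSL ℝ).continuous₂ hf
  refine ae_eq_of_integral_contDiff_smul_eq
    ((Lp.memLp _).locallyIntegrable (by norm_num)) hcont.locallyIntegrable fun g hg hgc => ?_
  set G : SchwartzMap E ℂ := (hgc.comp_left (g := ((↑) : ℝ → ℂ)) (by simp)).toSchwartzMap
    (by exact Complex.ofRealCLM.contDiff.comp hg) with hG
  have hGx : ∀ x, G x = (g x : ℂ) := fun x => rfl
  have h1 := DFunLike.congr_fun (Lp.fourier_toTemperedDistribution_eq (hf2.toLp f)) G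
  rw [TemperedDistribution.fourier_apply, Lp.toTemperedDistribution_apply,
    Lp.toTemperedDistribution_apply] at h1
  have h2 : ∫ x, 𝓕 f x * G x = ∫ x, f x * 𝓕 (G : E → ℂ) x := by
    have := VectorFourier.integral_bilin_fourierIntegral_eq_flip (ContinuousLinearMap.mul ℂ ℂ)
      (L := innerₗ E) (μ := volume) (ν := volume)
      Real.continuous_fourierChar (by exact (innerSL ℝ).continuous₂) hf G.integrable
    simp only [flip_innerₗ] at this
    exact this
  have h3 : ∫ x, (𝓕 G : SchwartzMap E ℂ) x • (hf2.toLp f) x = ∫ x, f x * 𝓕 (G : E → ℂ) x := by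
    refine integral_congr_ae ?_
    filter_upwards [hf2.coeFn_toLp] with x hx
    rw [hx, SchwartzMap.fourier_coe, smul_eq_mul, mul_comm]
  rw [h3, ← h2] at h1
  simp only [hGx, smul_eq_mul] at h1
  simp only [Complex.real_smul]
  rw [← h1]
  simp only [mul_comm]

theorem lintegral_enorm_fourier_sq {E : Type*} [NormedAddCommGroup E] [InnerProductSpace ℝ E]
    [FiniteDimensional ℝ E] [MeasurableSpace E] [BorelSpace E] {f : E → ℂ}
    (hf : Integrable f) (hf2 : MemLp f 2) :
    ∫⁻ x, ‖𝓕 f x‖ₑ ^ 2 = ∫⁻ x, ‖f x‖ₑ ^ 2 := by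
  have key : ∀ g : E → ℂ, ∫⁻ x, ‖g x‖ₑ ^ 2 = eLpNorm g 2 volume ^ 2 := fun g => by
    have := eLpNorm_nnreal_pow_eq_lintegral (f := g) (μ := volume) (p := 2) (by norm_num)
    simpa using this.symm
  rw [key, key, ← eLpNorm_congr_ae (fourier_toLp_ae_eq hf hf2), ← eLpNorm_congr_ae hf2.coeFn_toLp,
    ← Lp.enorm_def, ← Lp.enorm_def, ← ofReal_norm, ← ofReal_norm, Lp.norm_fourier_eq]

/-! ### Exponentials and the Fourier transform of a domain -/

section ExpTransform

variable {d : ℕ}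

/-- The integral over `Ω` of the exponential `e_η`, that is, the Fourier transform of the indicator
of `Ω` at `-η`. -/
noncomputable def expTransform (Ω : Set (EuclideanSpace ℝ (Fin d)))
    (η : EuclideanSpace ℝ (Fin d)) : ℂ :=
  ∫ x in Ω, expFun η x

theorem continuous_expFun (η : EuclideanSpace ℝ (Fin d)) : Continuous (expFun η) := by
  unfold expFun; fun_prop

theorem norm_expFun (η x : EuclideanSpace ℝ (Fin d)) : ‖expFun η x‖ = 1 := by
  have : expFun η x = Complex.exp ((2 * Real.pi * inner ℝ η x : ℝ) * Complex.I) := by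
    unfold expFun; push_cast; ring_nf
  rw [this, Complex.norm_exp_ofReal_mul_I]

theorem conj_expFun (η x : EuclideanSpace ℝ (Fin d)) :
    (starRingEnd ℂ) (expFun η x) = expFun (-η) x := by
  unfold expFun
  rw [← Complex.exp_conj]
  congr 1
  simp [inner_neg_left, Complex.conj_ofNat]

theorem expFun_add (η η' x : EuclideanSpace ℝ (Fin d)) :
    expFun (η + η') x = expFun η x * expFun η' x := by
  unfold expFun
  rw [← Complex.exp_add, inner_add_left]
  push_cast
  ring_nf

theorem expTransform_neg (Ω : Set (EuclideanSpace ℝ (Fin d))) (η : EuclideanSpace ℝ (Fin d)) :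
    expTransform Ω (-η) = (starRingEnd ℂ) (expTransform Ω η) := by
  unfold expTransform
  rw [← integral_conj]
  simp only [conj_expFun]

theorem expTransform_eq_fourier {Ω : Set (EuclideanSpace ℝ (Fin d))} (hΩ : MeasurableSet Ω)
    (η : EuclideanSpace ℝ (Fin d)) :
    expTransform Ω η = 𝓕 (Ω.indicator (fun _ => (1 : ℂ))) (-η) := by
  rw [Real.fourier_eq', expTransform, ← integral_indicator hΩ]
  congr 1 with x
  by_cases hx : x ∈ Ω
  · simp only [hx, Set.indicator_of_mem, expFun, inner_neg_right, real_inner_comm, smul_eq_mul,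
      mul_one]
    congr 1
    push_cast
    ring
  · simp [hx]

theorem lintegral_enorm_expTransform_sq {Ω : Set (EuclideanSpace ℝ (Fin d))}
    (hΩ : MeasurableSet Ω) (hvol : volume Ω ≠ ⊤) :
    ∫⁻ η, ‖expTransform Ω η‖ₑ ^ 2 = volume Ω := by
  simp_rw [expTransform_eq_fourier hΩ]
  have h1 : MemLp (Ω.indicator (fun _ => (1 : ℂ))) 1 volume :=
    memLp_indicator_const 1 hΩ 1 (Or.inr hvol)
  have h2 : MemLp (Ω.indicator (fun _ => (1 : ℂ))) 2 volume :=
    memLp_indicator_const 2 hΩ 1 (Or.inr hvol)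
  rw [lintegral_neg_eq_self (fun η => ‖𝓕 (Ω.indicator (fun _ => (1 : ℂ))) η‖ₑ ^ 2),
    lintegral_enorm_fourier_sq (memLp_one_iff_integrable.1 h1) h2]
  have : (fun x => ‖Ω.indicator (fun _ => (1 : ℂ)) x‖ₑ ^ 2) = Ω.indicator 1 := by
    ext x
    by_cases hx : x ∈ Ω <;> simp [hx]
  rw [this, lintegral_indicator_one hΩ]

theorem continuous_expTransform {Ω : Set (EuclideanSpace ℝ (Fin d))}
    (hvol : volume Ω ≠ ⊤) : Continuous (expTransform Ω) := by
  have : IsFiniteMeasure (volume.restrict Ω) := ⟨by simpa using hvol.lt_top⟩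
  refine continuous_of_dominated (bound := fun _ => 1)
    (fun η => (continuous_expFun η).aestronglyMeasurable)
    (fun η => ae_of_all _ fun x => (norm_expFun η x).le) (integrable_const _)
    (ae_of_all _ fun x => ?_)
  unfold expFun
  fun_prop

theorem inner_eq_expTransform {Ω : Set (EuclideanSpace ℝ (Fin d))}
    {f g : Lp ℂ 2 (volume.restrict Ω)} {η η' : EuclideanSpace ℝ (Fin d)}
    (hf : f =ᵐ[volume.restrict Ω] expFun η) (hg : g =ᵐ[volume.restrict Ω] expFun η') :
    inner ℂ f g = expTransform Ω (η' - η) := by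
  rw [L2.inner_def, expTransform]
  refine integral_congr_ae ?_
  filter_upwards [hf, hg] with x hx hx'
  rw [hx, hx', sub_eq_add_neg, expFun_add, ← conj_expFun]
  simp

theorem expTransform_eq_zero_of_isSpectralPair {Ω Λ : Set (EuclideanSpace ℝ (Fin d))}
    (h : IsSpectralPair Ω Λ) {l l' : EuclideanSpace ℝ (Fin d)} (hl : l ∈ Λ) (hl' : l' ∈ Λ)
    (hne : l ≠ l') : expTransform Ω (l' - l) = 0 := by
  obtain ⟨b, hb⟩ := h
  rw [← inner_eq_expTransform (hb ⟨l, hl⟩) (hb ⟨l', hl'⟩)]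
  exact b.orthonormal.2 (by simpa using hne)

/-- Parseval's identity for `e_η` in the basis given by a spectrum. -/
theorem tsum_enorm_expTransform_sq {Ω Λ : Set (EuclideanSpace ℝ (Fin d))}
    (hvol : volume Ω = 1) (h : IsSpectralPair Ω Λ) (η : EuclideanSpace ℝ (Fin d)) :
    ∑' l : Λ, ‖expTransform Ω (η - l)‖ₑ ^ 2 = 1 := by
  obtain ⟨b, hb⟩ := h
  have : IsFiniteMeasure (volume.restrict Ω) := ⟨by simp [hvol]⟩
  have hmem : MemLp (expFun η) 2 (volume.restrict Ω) :=
    MemLp.of_bound (continuous_expFun η).aestronglyMeasurable 1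
      (ae_of_all _ fun x => (norm_expFun η x).le)
  have hs := b.hasSum_inner_mul_inner (hmem.toLp _) (hmem.toLp _)
  rw [inner_eq_expTransform hmem.coeFn_toLp hmem.coeFn_toLp, sub_self] at hs
  have h0 : expTransform Ω 0 = 1 := by
    simp [expTransform, expFun, Measure.real, hvol]
  have hterm : ∀ l : Λ, inner ℂ (hmem.toLp _) (b l) * inner ℂ (b l) (hmem.toLp _) =
      ((‖expTransform Ω (η - l)‖ ^ 2 : ℝ) : ℂ) := fun l => by
    rw [inner_eq_expTransform hmem.coeFn_toLp (hb l), inner_eq_expTransform (hb l) hmem.coeFn_toLp,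
      ← neg_sub η, expTransform_neg, Complex.conj_mul']
    push_cast; rfl
  simp_rw [hterm, h0] at hs
  have hs' : HasSum (fun l : Λ => ‖expTransform Ω (η - l)‖ ^ 2) 1 := by
    exact Complex.hasSum_ofReal.1 (by simpa using hs)
  have := ENNReal.ofReal_tsum_of_nonneg (fun l => by positivity) hs'.summable
  rw [hs'.tsum_eq] at this
  rw [← ENNReal.ofReal_one, this]
  congr 1 with l
  rw [← ofReal_norm, ENNReal.ofReal_pow (norm_nonneg _)]

/-- A packing obstruction to spectrality: if, for some `δ` and every `N`, the transform of `Ω` does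
not vanish on the balls of radius `2 δ` around `0, v, …, N v` for some long enough `v`, then the
balls of radius `δ` around the points `j v - l` are disjoint, which for large `N` contradicts
`∫ |F|² = 1`. -/
theorem not_isSpectralPair_of_expTransform_ne_zero {Ω Λ : Set (EuclideanSpace ℝ (Fin d))}
    (hΩ : MeasurableSet Ω) (hvol : volume Ω = 1) {δ : ℝ} (hδ : 0 < δ)
    (hne : ∀ N : ℕ, ∃ v : EuclideanSpace ℝ (Fin d), 2 * δ ≤ ‖v‖ ∧ ∀ j : ℕ, j ≤ N →
      ∀ w, ‖w‖ < 2 * δ → expTransform Ω ((j : ℝ) • v + w) ≠ 0) :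
    ¬ IsSpectralPair Ω Λ := by
  intro hsp
  have htop : volume Ω ≠ ⊤ := by simp [hvol]
  set B := volume (Metric.ball (0 : EuclideanSpace ℝ (Fin d)) δ) with hB
  have hBpos : B ≠ 0 := (Metric.measure_ball_pos _ _ hδ).ne'
  -- the points `j v - l` with `j ≤ N`, `l ∈ Λ` are jointly separated: a difference of two of them
  -- is `k v` plus the difference of two points of `Λ`, where the transform vanishes
  have hsep : ∀ (N : ℕ) (v : EuclideanSpace ℝ (Fin d)), 2 * δ ≤ ‖v‖ → (∀ j : ℕ, j ≤ N →
      ∀ w, ‖w‖ < 2 * δ → expTransform Ω ((j : ℝ) • v + w) ≠ 0) →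
      Pairwise (Function.onFun Disjoint fun p : Fin (N + 1) × Λ =>
        Metric.ball ((p.1 : ℝ) • v - p.2 : EuclideanSpace ℝ (Fin d)) δ) := by
    intro N v hv hF
    have aux : ∀ p q : Fin (N + 1) × Λ, p ≠ q → p.1 ≤ q.1 → ∀ x,
        x ∈ Metric.ball ((p.1 : ℝ) • v - p.2 : EuclideanSpace ℝ (Fin d)) δ →
        x ∉ Metric.ball ((q.1 : ℝ) • v - q.2 : EuclideanSpace ℝ (Fin d)) δ := by
      rintro ⟨i, l⟩ ⟨j, m⟩ hpq hij x hx hy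
      simp only [mem_ball_iff_norm] at hx hy hij
      have hij' : (i : ℕ) ≤ j := hij
      set w := (x - ((i : ℝ) • v - (l : EuclideanSpace ℝ (Fin d)))) -
        (x - ((j : ℝ) • v - (m : EuclideanSpace ℝ (Fin d)))) with hw
      have hwn : ‖-w‖ < 2 * δ := by
        rw [norm_neg, two_mul]
        exact (norm_sub_le _ _).trans_lt (add_lt_add hx hy)
      have heq : (m : EuclideanSpace ℝ (Fin d)) - l = ((j - i : ℕ) : ℝ) • v + -w := by
        rw [hw, Nat.cast_sub hij', sub_smul]; abel
      by_cases hlm : l = m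
      · subst hlm
        have hlt : (i : ℕ) < j := lt_of_le_of_ne hij' fun h => hpq (by
          rw [Prod.mk.injEq]; exact ⟨Fin.ext h, rfl⟩)
        have h1 : w = ((j - i : ℕ) : ℝ) • v := by
          rw [sub_self, ← sub_eq_add_neg] at heq
          exact (sub_eq_zero.1 heq.symm).symm
        have h2 : (1 : ℝ) ≤ ((j - i : ℕ) : ℝ) := by
          exact_mod_cast Nat.sub_pos_of_lt hlt
        rw [norm_neg, h1, norm_smul, Real.norm_natCast] at hwn
        nlinarith [norm_nonneg v]
      · have hz := expTransform_eq_zero_of_isSpectralPair hsp l.2 m.2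
          (fun h => hlm (Subtype.ext h))
        rw [heq] at hz
        exact hF _ (by omega) _ hwn hz
    intro p q hpq
    rw [Function.onFun, Set.disjoint_left]
    intro x hx hy
    rcases le_total p.1 q.1 with h | h
    · exact aux p q hpq h x hx hy
    · exact aux q p hpq.symm h x hy hx
  have hcount : Countable Λ := by
    obtain ⟨v, hv, hF⟩ := hne 0
    have := Set.PairwiseDisjoint.countable_of_isOpen
      (s := fun p : Fin (0 + 1) × Λ =>
        Metric.ball ((p.1 : ℝ) • v - p.2 : EuclideanSpace ℝ (Fin d)) δ) (a := Set.univ)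
      (fun p _ q _ h => hsep 0 v hv hF h)
      (fun _ _ => Metric.isOpen_ball) (fun _ _ => Metric.nonempty_ball.2 hδ)
    rw [Set.countable_univ_iff] at this
    exact Function.Injective.countable (f := fun l : Λ => ((0 : Fin 1), l))
      (fun l m h => (Prod.mk.inj h).2)
  have hmeas : Measurable fun η => ‖expTransform Ω η‖ₑ ^ 2 :=
    (continuous_expTransform htop).measurable.enorm.pow_const 2
  have hbound : ∀ N : ℕ, ((N + 1 : ℕ) : ENNReal) * B ≤ 1 := by
    intro N
    obtain ⟨v, hv, hF⟩ := hne N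
    have hball : ∀ c : EuclideanSpace ℝ (Fin d),
        ∫⁻ x in Metric.ball c δ, ‖expTransform Ω x‖ₑ ^ 2 =
          ∫⁻ w in Metric.ball 0 δ, ‖expTransform Ω (w + c)‖ₑ ^ 2 := by
      intro c
      rw [← (measurePreserving_add_right volume c).setLIntegral_comp_preimage
        Metric.isOpen_ball.measurableSet hmeas]
      congr 2
      ext w
      simp
    have hrow : ∀ i : Fin (N + 1),
        ∑' l : Λ, ∫⁻ x in Metric.ball ((i : ℝ) • v - l : EuclideanSpace ℝ (Fin d)) δ,
          ‖expTransform Ω x‖ₑ ^ 2 = B := by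
      intro i
      simp_rw [hball]
      rw [← lintegral_tsum (f := fun (l : Λ) w =>
        ‖expTransform Ω (w + ((i : ℝ) • v - l))‖ₑ ^ 2) fun l : Λ =>
        (hmeas.comp (measurable_add_const ((i : ℝ) • v - (l : EuclideanSpace ℝ (Fin d))))).aemeasurable]
      have : ∀ w, ∑' l : Λ, ‖expTransform Ω (w + ((i : ℝ) • v - l))‖ₑ ^ 2 = 1 := fun w => by
        rw [← tsum_enorm_expTransform_sq hvol hsp (w + (i : ℝ) • v)]
        simp only [add_sub_assoc]
      simp_rw [this]
      simp [hB]
    calc ((N + 1 : ℕ) : ENNReal) * B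
        = ∑' i : Fin (N + 1), ∑' l : Λ,
          ∫⁻ x in Metric.ball ((i : ℝ) • v - l : EuclideanSpace ℝ (Fin d)) δ,
            ‖expTransform Ω x‖ₑ ^ 2 := by
          simp_rw [hrow]
          rw [tsum_fintype]
          simp
      _ = ∑' p : Fin (N + 1) × Λ,
          ∫⁻ x in Metric.ball ((p.1 : ℝ) • v - p.2 : EuclideanSpace ℝ (Fin d)) δ,
            ‖expTransform Ω x‖ₑ ^ 2 := (ENNReal.tsum_prod (f := fun (i : Fin (N + 1)) (l : Λ) =>
              ∫⁻ x in Metric.ball ((i : ℝ) • v - l : EuclideanSpace ℝ (Fin d)) δ,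
            ‖expTransform Ω x‖ₑ ^ 2)).symm
      _ = ∫⁻ x in ⋃ p : Fin (N + 1) × Λ,
            Metric.ball ((p.1 : ℝ) • v - p.2 : EuclideanSpace ℝ (Fin d)) δ,
            ‖expTransform Ω x‖ₑ ^ 2 :=
          (lintegral_iUnion (fun _ => Metric.isOpen_ball.measurableSet) (hsep N v hv hF) _).symm
      _ ≤ ∫⁻ x, ‖expTransform Ω x‖ₑ ^ 2 := setLIntegral_le_lintegral _ _
      _ = 1 := by rw [lintegral_enorm_expTransform_sq hΩ htop, hvol]
  obtain ⟨n, hn⟩ := ENNReal.exists_nat_mul_gt hBpos (ENNReal.one_ne_top)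
  have h1 := hbound n
  refine absurd (hn.trans_le ?_) (not_lt.2 h1)
  gcongr
  exact Nat.le_succ n

end ExpTransform

/-! ### Slicing by lines parallel to `ξ` -/

section Slicing

variable {n : ℕ}

/-- An isometry `ι` onto the hyperplane `ξᗮ`. The coordinates `(y, s) ↦ ι y + s ξ` preserve volume.
Modelling the hyperplane on `EuclideanSpace ℝ (Fin n)` makes its volume the Lebesgue measure; the
subtype `ξᗮ` would also carry the restricted volume, which is zero. -/
theorem exists_orthogonal_slicing {ξ : EuclideanSpace ℝ (Fin (n + 1))} (hξ : ‖ξ‖ = 1) :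
    ∃ ι : EuclideanSpace ℝ (Fin n) →ₗᵢ[ℝ] EuclideanSpace ℝ (Fin (n + 1)),
      (∀ y, inner ℝ ξ (ι y) = 0) ∧
      (∀ x, ∃ y, x = ι y + (inner ℝ ξ x : ℝ) • ξ) ∧
      MeasurePreserving (fun p : EuclideanSpace ℝ (Fin n) × ℝ => ι p.1 + p.2 • ξ) := by
  have hξ0 : ξ ≠ 0 := fun h => by simp [h] at hξ
  have : Fact (Module.finrank ℝ (EuclideanSpace ℝ (Fin (n + 1))) = n + 1) := ⟨by simp⟩
  let ι : EuclideanSpace ℝ (Fin n) →ₗᵢ[ℝ] EuclideanSpace ℝ (Fin (n + 1)) :=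
    (Submodule.subtypeₗᵢ _).comp
      (OrthonormalBasis.fromOrthogonalSpanSingleton n hξ0).repr.symm.toLinearIsometry
  have hι : ∀ y, inner ℝ ξ (ι y) = 0 := fun y =>
    Submodule.mem_orthogonal_singleton_iff_inner_right.1
      ((OrthonormalBasis.fromOrthogonalSpanSingleton n hξ0).repr.symm y).2
  let T : WithLp 2 (EuclideanSpace ℝ (Fin n) × ℝ) →ₗᵢ[ℝ] EuclideanSpace ℝ (Fin (n + 1)) :=
    { toFun := fun p => ι p.fst + p.snd • ξ
      map_add' := fun p q => by simp [add_smul]; abel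
      map_smul' := fun c p => by simp [mul_smul]
      norm_map' := fun p => by
        rw [← sq_eq_sq₀ (norm_nonneg _) (norm_nonneg _), WithLp.prod_norm_sq_eq_of_L2]
        change ‖ι p.fst + p.snd • ξ‖ ^ 2 = _
        rw [norm_add_sq_real, inner_smul_right, real_inner_comm, hι, norm_smul, hξ]
        simp }
  have hfr : Module.finrank ℝ (WithLp 2 (EuclideanSpace ℝ (Fin n) × ℝ)) =
      Module.finrank ℝ (EuclideanSpace ℝ (Fin (n + 1))) := by
    rw [(WithLp.linearEquiv 2 ℝ (EuclideanSpace ℝ (Fin n) × ℝ)).finrank_eq]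
    simp
  let T' := T.toLinearIsometryEquiv hfr
  refine ⟨ι, hι, fun x => ?_, ?_⟩
  · obtain ⟨p, hp⟩ := T'.surjective x
    replace hp : ι p.fst + p.snd • ξ = x := hp
    refine ⟨p.fst, ?_⟩
    rw [← hp, inner_add_right, hι, inner_smul_right, real_inner_self_eq_norm_sq, hξ]
    simp
  · exact T'.measurePreserving.comp (WithLp.volume_preserving_toLp _ _)

/-! ### Oscillatory integrals -/

theorem expFun_eq_fourierChar {d : ℕ} (η x : EuclideanSpace ℝ (Fin d)) :
    expFun η x = 𝐞 (inner ℝ η x) := by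
  rw [expFun, Real.fourierChar_apply]
  congr 1
  push_cast
  ring

theorem norm_fourierChar_sub_one_le (u : ℝ) : ‖(𝐞 u : ℂ) - 1‖ ≤ 2 * Real.pi * |u| := by
  rw [Real.fourierChar_apply, mul_comm]
  refine (Real.norm_exp_I_mul_ofReal_sub_one_le).trans ?_
  rw [Real.norm_eq_abs, abs_mul, abs_of_pos Real.two_pi_pos]

theorem integral_Icc_fourierChar {τ : ℝ} (hτ : τ ≠ 0) {a b : ℝ} (hab : a ≤ b) :
    2 * Real.pi * Complex.I * τ * ∫ s in Set.Icc a b, (𝐞 (τ * s) : ℂ) = 𝐞 (τ * b) - 𝐞 (τ * a) := by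
  rw [integral_Icc_eq_integral_Ioc, ← intervalIntegral.integral_of_le hab]
  have hc : (2 * Real.pi * Complex.I * τ : ℂ) ≠ 0 := by
    simp [Real.pi_ne_zero, hτ]
  have h : ∀ s : ℝ, (𝐞 (τ * s) : ℂ) = Complex.exp (2 * Real.pi * Complex.I * τ * s) := fun s => by
    rw [Real.fourierChar_apply]
    congr 1
    push_cast
    ring
  simp_rw [h]
  rw [integral_exp_mul_complex hc, mul_div_cancel₀ _ hc]

/-- The Riemann-Lebesgue lemma for a phase `g` whose distribution is absolutely continuous. -/
theorem tendsto_integral_fourierChar_of_map_absolutelyContinuous {α : Type*} [MeasurableSpace α]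
    {μ : Measure α} [IsFiniteMeasure μ] {g : α → ℝ} (hg : Measurable g) (hac : μ.map g ≪ volume) :
    Filter.Tendsto (fun τ : ℝ => ∫ y, (𝐞 (τ * g y) : ℂ) ∂μ) Filter.atTop (nhds 0) := by
  have h1 : ∀ τ : ℝ, ∫ y, (𝐞 (τ * g y) : ℂ) ∂μ =
      ∫ u : ℝ, (𝐞 (-(u * -τ)) : Circle) • (((μ.map g).rnDeriv volume u).toReal : ℂ) := fun τ => by
    have hm : AEStronglyMeasurable (fun u : ℝ => (𝐞 (τ * u) : ℂ)) (μ.map g) := by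
      refine Continuous.aestronglyMeasurable ?_
      exact continuous_subtype_val.comp (Real.continuous_fourierChar.comp (by fun_prop))
    rw [← integral_map hg.aemeasurable hm, ← integral_rnDeriv_smul hac]
    congr 1 with u
    rw [Circle.smul_def, smul_eq_mul, Complex.real_smul, mul_comm]
    congr 3
    ring
  simp_rw [h1]
  refine (Real.tendsto_integral_exp_smul_cocompact _).comp ?_
  exact (Filter.tendsto_neg_atTop_atBot).mono_right atBot_le_cocompact

/-- If the distribution of the phase `g` is absolutely continuous apart from atoms in the finite set
`S`, then only the atoms contribute to the oscillatory integral in the limit. -/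
theorem tendsto_integral_fourierChar_sub_sum {α : Type*} [MeasurableSpace α]
    {μ : Measure α} [IsFiniteMeasure μ] {g : α → ℝ} (hg : Measurable g) (S : Finset ℝ)
    (hnull : ∀ N : Set ℝ, MeasurableSet N → volume N = 0 → μ {y | g y ∈ N ∧ g y ∉ S} = 0) :
    Filter.Tendsto (fun τ : ℝ => ∫ y, (𝐞 (τ * g y) : ℂ) ∂μ -
      ∑ s ∈ S, (μ.real {y | g y = s} : ℂ) * 𝐞 (τ * s)) Filter.atTop (nhds 0) := by
  have hS : MeasurableSet (g ⁻¹' S) := hg S.measurableSet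
  have hcont : Continuous fun u : ℝ => (𝐞 u : ℂ) :=
    continuous_subtype_val.comp Real.continuous_fourierChar
  have hac : (μ.restrict (g ⁻¹' S)ᶜ).map g ≪ volume := by
    refine Measure.AbsolutelyContinuous.mk fun N hN hN0 => ?_
    rw [Measure.map_apply hg hN, Measure.restrict_apply (hg hN)]
    exact hnull N hN hN0
  refine (tendsto_integral_fourierChar_of_map_absolutelyContinuous hg hac).congr fun τ => ?_
  have hint : Integrable (fun y => (𝐞 (τ * g y) : ℂ)) μ :=
    Integrable.of_bound (hcont.measurable.comp (hg.const_mul τ)).aestronglyMeasurable 1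
      (ae_of_all _ fun y => (Circle.norm_coe _).le)
  rw [← integral_add_compl hS hint]
  have h2 : ∫ y in g ⁻¹' S, (𝐞 (τ * g y) : ℂ) ∂μ =
      ∑ s ∈ S, (μ.real {y | g y = s} : ℂ) * 𝐞 (τ * s) := by
    have hU : g ⁻¹' S = ⋃ s ∈ S, {y | g y = s} := by ext y; simp
    rw [hU, integral_biUnion_finset (s := fun s => {y | g y = s}) S (fun s _ => hg (measurableSet_singleton s))
      (fun s _ t _ hst => Set.disjoint_left.2 fun y hy hy' => hst (hy.symm.trans hy'))
      (fun s _ => hint.integrableOn)]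
    refine Finset.sum_congr rfl fun s _ => ?_
    have hms : MeasurableSet {y | g y = s} := hg (measurableSet_singleton s)
    rw [setIntegral_congr_fun (g := fun _ => (𝐞 (τ * s) : ℂ)) hms
      (fun y hy => congrArg (fun u => (𝐞 (τ * u) : ℂ)) (show g y = s from hy)), setIntegral_const]
    simp
  rw [h2]
  ring

/-! ### Polyhedra as slabs over a hyperplane -/

/-- The polyhedron cut out by the half-spaces `{x | ⟪a, x⟫ ≤ b}`, `(a, b) ∈ K`. -/
def polyhedron {d : ℕ} (K : Finset (EuclideanSpace ℝ (Fin d) × ℝ)) :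
    Set (EuclideanSpace ℝ (Fin d)) :=
  {x | ∀ h ∈ K, inner ℝ h.1 x ≤ h.2}

theorem isClosed_polyhedron {d : ℕ} (K : Finset (EuclideanSpace ℝ (Fin d) × ℝ)) :
    IsClosed (polyhedron K) := by
  have : polyhedron K = ⋂ h ∈ K, {x | inner ℝ h.1 x ≤ h.2} := by ext; simp [polyhedron]
  rw [this]
  exact isClosed_biInter fun h _ => isClosed_le (by fun_prop) (by fun_prop)

/-- The height `s` at which the line `s ↦ ι y + s ξ` meets the bounding hyperplane of the half-space
`h`. It has this meaning only if the line is transversal to the hyperplane, `⟪h.1, ξ⟫ ≠ 0`; else it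
is the junk value `0`. -/
noncomputable def fiberRoot (ι : EuclideanSpace ℝ (Fin n) →ₗᵢ[ℝ] EuclideanSpace ℝ (Fin (n + 1)))
    (ξ : EuclideanSpace ℝ (Fin (n + 1))) (h : EuclideanSpace ℝ (Fin (n + 1)) × ℝ)
    (y : EuclideanSpace ℝ (Fin n)) : ℝ :=
  (h.2 - inner ℝ h.1 (ι y)) / inner ℝ h.1 ξ

theorem continuous_fiberRoot
    (ι : EuclideanSpace ℝ (Fin n) →ₗᵢ[ℝ] EuclideanSpace ℝ (Fin (n + 1)))
    (ξ : EuclideanSpace ℝ (Fin (n + 1))) (h : EuclideanSpace ℝ (Fin (n + 1)) × ℝ) :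
    Continuous (fiberRoot ι ξ h) := by
  have := ι.continuous
  unfold fiberRoot
  fun_prop

/-- In the coordinates `(y, s) ↦ ι y + s ξ` the set `P` is `{(y, s) | y ∈ Q, A y ≤ s ≤ B y}`, where
each end point lies on a hyperplane bounding a half-space of `H`. Fibres with `B y < A y` are empty,
so that `Q` may be larger than the projection of `P`. -/
structure IsSlab (ι : EuclideanSpace ℝ (Fin n) →ₗᵢ[ℝ] EuclideanSpace ℝ (Fin (n + 1)))
    (ξ : EuclideanSpace ℝ (Fin (n + 1))) (H : Finset (EuclideanSpace ℝ (Fin (n + 1)) × ℝ))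
    (P : Set (EuclideanSpace ℝ (Fin (n + 1)))) (Q : Set (EuclideanSpace ℝ (Fin n)))
    (A B : EuclideanSpace ℝ (Fin n) → ℝ) : Prop where
  measurableSet_base : MeasurableSet Q
  measurable_lower : Measurable A
  measurable_upper : Measurable B
  mem_iff : ∀ y s, ι y + s • ξ ∈ P ↔ y ∈ Q ∧ A y ≤ s ∧ s ≤ B y
  lower_eq : ∀ y, ∃ h ∈ H, inner ℝ h.1 ξ ≠ 0 ∧ A y = fiberRoot ι ξ h y
  upper_eq : ∀ y, ∃ h ∈ H, inner ℝ h.1 ξ ≠ 0 ∧ B y = fiberRoot ι ξ h y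

/-- The half-spaces `h` with `⟪h.1, ξ⟫` positive, negative and zero bound the fibres from above, from
below, and restrict the base, respectively. The two half-spaces assumed to lie in `K` ensure that
there is at least one bound on either side. -/
theorem exists_isSlab_polyhedron
    (ι : EuclideanSpace ℝ (Fin n) →ₗᵢ[ℝ] EuclideanSpace ℝ (Fin (n + 1)))
    {ξ : EuclideanSpace ℝ (Fin (n + 1))} (hξ : ‖ξ‖ = 1)
    {K H : Finset (EuclideanSpace ℝ (Fin (n + 1)) × ℝ)} (hKH : K ⊆ H) {R : ℝ}
    (h₁ : (ξ, R) ∈ K) (h₂ : (-ξ, R) ∈ K) :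
    ∃ Q A B, IsSlab ι ξ H (polyhedron K) Q A B := by
  classical
  obtain ⟨Kp, hKp⟩ : ∃ Kp : Finset (EuclideanSpace ℝ (Fin (n + 1)) × ℝ),
      ∀ h, h ∈ Kp ↔ h ∈ K ∧ 0 < inner ℝ h.1 ξ := ⟨K.filter _, fun h => Finset.mem_filter⟩
  obtain ⟨Kn, hKn⟩ : ∃ Kn : Finset (EuclideanSpace ℝ (Fin (n + 1)) × ℝ),
      ∀ h, h ∈ Kn ↔ h ∈ K ∧ inner ℝ h.1 ξ < 0 := ⟨K.filter _, fun h => Finset.mem_filter⟩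
  have hpos : Kp.Nonempty := ⟨_, (hKp _).2 ⟨h₁, by simp [hξ]⟩⟩
  have hneg : Kn.Nonempty := ⟨_, (hKn _).2 ⟨h₂, by simp [hξ]⟩⟩
  have hQ : MeasurableSet {y | ∀ h ∈ K, inner ℝ h.1 ξ = 0 → inner ℝ h.1 (ι y) ≤ h.2} := by
    have := ι.continuous
    have hU : {y | ∀ h ∈ K, inner ℝ h.1 ξ = 0 → inner ℝ h.1 (ι y) ≤ h.2} =
        ⋂ h ∈ K.filter fun h => inner ℝ h.1 ξ = 0, {y | inner ℝ h.1 (ι y) ≤ h.2} := by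
      ext y; simp
    rw [hU]
    exact (isClosed_biInter fun h _ => isClosed_le (by fun_prop) (by fun_prop)).measurableSet
  have hA : Measurable fun y => Kn.sup' hneg
      fun h => fiberRoot ι ξ h y :=
    (Continuous.finset_sup'_apply hneg fun h _ => continuous_fiberRoot ι ξ h).measurable
  have hB : Measurable fun y => Kp.inf' hpos
      fun h => fiberRoot ι ξ h y :=
    (Continuous.finset_inf'_apply hpos fun h _ => continuous_fiberRoot ι ξ h).measurable
  refine ⟨_, _, _, hQ, hA, hB, fun y s => ?_, fun y => ?_, fun y => ?_⟩
  · simp only [polyhedron, Finset.sup'_le_iff,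
      Finset.le_inf'_iff, hKp, hKn]
    constructor
    · intro h
      refine ⟨fun k hk hk0 => ?_, fun k hk => ?_, fun k hk => ?_⟩
      · have := h k hk
        rwa [inner_add_right, inner_smul_right, hk0, mul_zero, add_zero] at this
      · have := h k hk.1
        rw [inner_add_right, inner_smul_right] at this
        rw [fiberRoot, div_le_iff_of_neg hk.2]
        linarith
      · have := h k hk.1
        rw [inner_add_right, inner_smul_right] at this
        rw [fiberRoot, le_div_iff₀ hk.2]
        linarith
    · rintro ⟨h0, hA, hB⟩ k hk
      rw [inner_add_right, inner_smul_right]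
      rcases lt_trichotomy (inner ℝ k.1 ξ : ℝ) 0 with hlt | heq | hgt
      · have := hA k ⟨hk, hlt⟩
        rw [fiberRoot, div_le_iff_of_neg hlt] at this
        linarith
      · have := h0 k hk heq
        rw [heq]; linarith
      · have := hB k ⟨hk, hgt⟩
        rw [fiberRoot, le_div_iff₀ hgt] at this
        linarith
  · obtain ⟨k, hk, hk'⟩ := Finset.exists_mem_eq_sup' hneg fun h => fiberRoot ι ξ h y
    rw [hKn] at hk
    exact ⟨k, hKH hk.1, hk.2.ne, hk'⟩
  · obtain ⟨k, hk, hk'⟩ := Finset.exists_mem_eq_inf' hpos fun h => fiberRoot ι ξ h y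
    rw [hKp] at hk
    exact ⟨k, hKH hk.1, hk.2.ne', hk'⟩

/-- A non-zero linear functional on the hyperplane pulls null sets back to null sets. -/
theorem volume_setOf_inner_mem_eq_zero
    (ι : EuclideanSpace ℝ (Fin n) →ₗᵢ[ℝ] EuclideanSpace ℝ (Fin (n + 1)))
    {a : EuclideanSpace ℝ (Fin (n + 1))} (ha : ∃ y, inner ℝ a (ι y) ≠ (0 : ℝ)) {N : Set ℝ}
    (hN : volume N = 0) : volume {y | inner ℝ a (ι y) ∈ N} = 0 := by
  set L : EuclideanSpace ℝ (Fin n) →ₗ[ℝ] ℝ := (innerₗ _ a).comp ι.toLinearMap with hL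
  have hsurj : Function.Surjective L := by
    refine LinearMap.surjective fun h => ?_
    obtain ⟨y, hy⟩ := ha
    exact hy (DFunLike.congr_fun h y)
  have h1 : ∀ᵐ u : ℝ, u ∈ (toMeasurable volume N)ᶜ := by
    rw [ae_iff]
    simpa [measure_toMeasurable] using hN
  have h2 := (ae_comp_linearMap_mem_iff L volume volume hsurj
    (measurableSet_toMeasurable volume N).compl).2 h1
  rw [ae_iff] at h2
  refine measure_mono_null (fun y hy => ?_) h2
  exact fun h => h (subset_toMeasurable volume N hy)

theorem volume_setOf_fiberRoot_mem_eq_zero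
    {ι : EuclideanSpace ℝ (Fin n) →ₗᵢ[ℝ] EuclideanSpace ℝ (Fin (n + 1))}
    {ξ : EuclideanSpace ℝ (Fin (n + 1))} {h : EuclideanSpace ℝ (Fin (n + 1)) × ℝ}
    (hξ : inner ℝ h.1 ξ ≠ (0 : ℝ)) (hne : ∃ y, inner ℝ h.1 (ι y) ≠ (0 : ℝ)) {N : Set ℝ}
    (hN : volume N = 0) : volume {y | fiberRoot ι ξ h y ∈ N} = 0 := by
  have hN' : volume ((fun u : ℝ => (h.2 - u) / inner ℝ h.1 ξ) ⁻¹' N) = 0 := by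
    have h1 : (fun u : ℝ => (h.2 - u) / inner ℝ h.1 ξ) ⁻¹' N =
        (fun u : ℝ => h.2 - u) ⁻¹' ((fun u : ℝ => u * (inner ℝ h.1 ξ)⁻¹) ⁻¹' N) := by
      ext u; simp [div_eq_mul_inv]
    rw [h1, (Measure.measurePreserving_sub_left volume h.2).measure_preimage_emb
      (MeasurableEquiv.subLeft h.2).measurableEmbedding, Real.volume_preimage_mul_right (inv_ne_zero hξ), hN, mul_zero]
  exact volume_setOf_inner_mem_eq_zero ι hne hN'

/-- A finite set of heights that contains the heights of all hyperplanes bounding half-spaces of `H`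
and orthogonal to `ξ`. The further elements coming from the other half-spaces (the junk value of a
division by `0` among them) are harmless: they only add terms equal to `0`. -/
noncomputable def orthogonalLevels (ξ : EuclideanSpace ℝ (Fin (n + 1)))
    (H : Finset (EuclideanSpace ℝ (Fin (n + 1)) × ℝ)) : Finset ℝ :=
  H.image fun h => h.2 / inner ℝ h.1 ξ

/-- A function that at each point equals one of the roots has an absolutely continuous distribution
apart from atoms at the orthogonal levels: the root of a hyperplane is constant if the hyperplane is
orthogonal to `ξ`, and a non-constant affine function otherwise. -/
theorem volume_setOf_mem_of_eq_fiberRoot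
    {ι : EuclideanSpace ℝ (Fin n) →ₗᵢ[ℝ] EuclideanSpace ℝ (Fin (n + 1))}
    {ξ : EuclideanSpace ℝ (Fin (n + 1))} {H : Finset (EuclideanSpace ℝ (Fin (n + 1)) × ℝ)}
    {g : EuclideanSpace ℝ (Fin n) → ℝ}
    (hg : ∀ y, ∃ h ∈ H, inner ℝ h.1 ξ ≠ 0 ∧ g y = fiberRoot ι ξ h y) {N : Set ℝ}
    (hN : volume N = 0) : volume {y | g y ∈ N ∧ g y ∉ orthogonalLevels ξ H} = 0 := by
  classical
  refine measure_mono_null (t := ⋃ h ∈ H.filter fun h => inner ℝ h.1 ξ ≠ 0 ∧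
    ∃ y, inner ℝ h.1 (ι y) ≠ (0 : ℝ), {y | fiberRoot ι ξ h y ∈ N}) ?_ ?_
  · rintro y ⟨hyN, hyS⟩
    obtain ⟨h, hH, hc, hgy⟩ := hg y
    simp only [Set.mem_iUnion]
    refine ⟨h, Finset.mem_filter.2 ⟨hH, hc, ?_⟩, show fiberRoot ι ξ h y ∈ N from hgy ▸ hyN⟩
    refine ⟨y, fun h0 => hyS ?_⟩
    rw [hgy, fiberRoot, h0, sub_zero]
    exact Finset.mem_image_of_mem _ hH
  · refine (measure_biUnion_null_iff (Finset.countable_toSet _)).2 ?_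
    intro h hh
    have hh' := (Finset.mem_filter.1 (Finset.mem_coe.1 hh)).2
    exact volume_setOf_fiberRoot_mem_eq_zero hh'.1 hh'.2 hN

/-! ### Asymptotics of the transform of a slab -/

theorem inner_slicing {ι : EuclideanSpace ℝ (Fin n) →ₗᵢ[ℝ] EuclideanSpace ℝ (Fin (n + 1))}
    {ξ : EuclideanSpace ℝ (Fin (n + 1))} (hξ : ‖ξ‖ = 1) (hι : ∀ y, inner ℝ ξ (ι y) = (0 : ℝ))
    (v y : EuclideanSpace ℝ (Fin n)) (τ s : ℝ) :
    inner ℝ (ι v + τ • ξ) (ι y + s • ξ) = inner ℝ v y + τ * s := by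
  rw [inner_add_left, inner_add_right, inner_add_right, inner_smul_left, inner_smul_left,
    inner_smul_right, inner_smul_right, hι, ι.inner_map_map, real_inner_self_eq_norm_sq, hξ,
    real_inner_comm ξ (ι v), hι]
  simp

theorem norm_slicing_sq {ι : EuclideanSpace ℝ (Fin n) →ₗᵢ[ℝ] EuclideanSpace ℝ (Fin (n + 1))}
    {ξ : EuclideanSpace ℝ (Fin (n + 1))} (hξ : ‖ξ‖ = 1) (hι : ∀ y, inner ℝ ξ (ι y) = (0 : ℝ))
    (y : EuclideanSpace ℝ (Fin n)) (s : ℝ) : ‖ι y + s • ξ‖ ^ 2 = ‖y‖ ^ 2 + s ^ 2 := by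
  rw [← real_inner_self_eq_norm_sq, inner_slicing hξ hι, real_inner_self_eq_norm_sq, sq s]

/-- The base points above which the fibre of a slab is a non-degenerate interval. -/
def openFibers (Q : Set (EuclideanSpace ℝ (Fin n))) (A B : EuclideanSpace ℝ (Fin n) → ℝ) :
    Set (EuclideanSpace ℝ (Fin n)) :=
  {y | y ∈ Q ∧ A y < B y}

/-- The signed area of the horizontal pieces of the boundary of a slab at height `s`: the upper ones
count positively, the lower ones negatively. -/
noncomputable def slabJump (Q : Set (EuclideanSpace ℝ (Fin n)))
    (A B : EuclideanSpace ℝ (Fin n) → ℝ) (s : ℝ) : ℝ :=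
  (volume.restrict (openFibers Q A B)).real {y | B y = s} -
    (volume.restrict (openFibers Q A B)).real {y | A y = s}

theorem continuous_coe_fourierChar : Continuous fun u : ℝ => (𝐞 u : ℂ) :=
  continuous_subtype_val.comp Real.continuous_fourierChar

theorem coe_fourierChar_add (u v : ℝ) : (𝐞 (u + v) : ℂ) = 𝐞 u * 𝐞 v := by
  rw [AddChar.map_add_eq_mul]; rfl

namespace IsSlab

variable {ι : EuclideanSpace ℝ (Fin n) →ₗᵢ[ℝ] EuclideanSpace ℝ (Fin (n + 1))}
  {ξ : EuclideanSpace ℝ (Fin (n + 1))} {H : Finset (EuclideanSpace ℝ (Fin (n + 1)) × ℝ)}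
  {P : Set (EuclideanSpace ℝ (Fin (n + 1)))} {Q : Set (EuclideanSpace ℝ (Fin n))}
  {A B : EuclideanSpace ℝ (Fin n) → ℝ}

theorem measurableSet_openFibers (hS : IsSlab ι ξ H P Q A B) :
    MeasurableSet (openFibers Q A B) :=
  hS.measurableSet_base.inter (measurableSet_lt hS.measurable_lower hS.measurable_upper)

theorem openFibers_subset (hS : IsSlab ι ξ H P Q A B) (hξ : ‖ξ‖ = 1)
    (hι : ∀ y, inner ℝ ξ (ι y) = (0 : ℝ)) {R : ℝ} (hR : P ⊆ Metric.closedBall 0 R) :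
    openFibers Q A B ⊆ Metric.closedBall 0 R := by
  rintro y ⟨hyQ, hAB⟩
  have h1 := hR ((hS.mem_iff y (A y)).2 ⟨hyQ, le_rfl, hAB.le⟩)
  rw [mem_closedBall_zero_iff] at h1 ⊢
  refine le_trans ?_ h1
  refine le_of_sq_le_sq ?_ (norm_nonneg _)
  rw [norm_slicing_sq hξ hι]
  nlinarith [sq_nonneg (A y)]

theorem volume_openFibers_lt_top (hS : IsSlab ι ξ H P Q A B) (hξ : ‖ξ‖ = 1)
    (hι : ∀ y, inner ℝ ξ (ι y) = (0 : ℝ)) (hP : Bornology.IsBounded P) :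
    volume (openFibers Q A B) < ⊤ := by
  obtain ⟨R, hR⟩ := hP.subset_closedBall 0
  exact (measure_mono (hS.openFibers_subset hξ hι hR)).trans_lt measure_closedBall_lt_top

/-- Integration of the exponential along the fibres of a slab. -/
theorem expTransform_eq (hS : IsSlab ι ξ H P Q A B) (hξ : ‖ξ‖ = 1)
    (hι : ∀ y, inner ℝ ξ (ι y) = (0 : ℝ))
    (hmp : MeasurePreserving (fun p : EuclideanSpace ℝ (Fin n) × ℝ => ι p.1 + p.2 • ξ))
    (hPm : MeasurableSet P) (hP : Bornology.IsBounded P) (v : EuclideanSpace ℝ (Fin n))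
    {τ : ℝ} (hτ : τ ≠ 0) :
    2 * Real.pi * Complex.I * τ * expTransform P (ι v + τ • ξ) =
      ∫ y in openFibers Q A B, (𝐞 (inner ℝ v y) : ℂ) * (𝐞 (τ * B y) - 𝐞 (τ * A y)) := by
  have hPfin : volume P ≠ ⊤ := hP.measure_lt_top.ne
  have hint : Integrable (P.indicator (expFun (ι v + τ • ξ))) := by
    rw [integrable_indicator_iff hPm]
    have : IsFiniteMeasure (volume.restrict P) := ⟨by simpa using hPfin.lt_top⟩
    exact Integrable.of_bound (continuous_expFun _).aestronglyMeasurable 1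
      (ae_of_all _ fun x => (norm_expFun _ x).le)
  have h1 : expTransform P (ι v + τ • ξ) = ∫ p : EuclideanSpace ℝ (Fin n) × ℝ,
      P.indicator (expFun (ι v + τ • ξ)) (ι p.1 + p.2 • ξ) := by
    rw [expTransform, ← integral_indicator hPm, ← hmp.map_eq,
      integral_map hmp.measurable.aemeasurable (by rw [hmp.map_eq]; exact hint.1)]
  have hint2 : Integrable (fun p : EuclideanSpace ℝ (Fin n) × ℝ =>
      P.indicator (expFun (ι v + τ • ξ)) (ι p.1 + p.2 • ξ)) (volume.prod volume) :=
    hmp.integrable_comp_of_integrable hint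
  rw [h1, Measure.volume_eq_prod, integral_prod _ hint2,
    ← integral_indicator hS.measurableSet_openFibers, ← integral_const_mul]
  congr 1 with y
  by_cases hy : y ∈ Q
  swap
  · have : ∀ s, P.indicator (expFun (ι v + τ • ξ)) (ι y + s • ξ) = 0 := fun s =>
      Set.indicator_of_notMem (fun h => hy ((hS.mem_iff y s).1 h).1) _
    simp only [this, integral_zero, mul_zero]
    rw [Set.indicator_of_notMem fun h : y ∈ openFibers Q A B => hy h.1]
  have h2 : ∀ s, P.indicator (expFun (ι v + τ • ξ)) (ι y + s • ξ) =
      (Set.Icc (A y) (B y)).indicator (fun s => (𝐞 (inner ℝ v y) : ℂ) * 𝐞 (τ * s)) s := fun s => by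
    by_cases hs : ι y + s • ξ ∈ P
    · rw [Set.indicator_of_mem hs, Set.indicator_of_mem (show s ∈ Set.Icc (A y) (B y) from ((hS.mem_iff y s).1 hs).2),
        expFun_eq_fourierChar, inner_slicing hξ hι, coe_fourierChar_add]
    · rw [Set.indicator_of_notMem hs,
        Set.indicator_of_notMem fun h : s ∈ Set.Icc (A y) (B y) => hs ((hS.mem_iff y s).2 ⟨hy, h⟩)]
  simp only [h2]
  rw [integral_indicator measurableSet_Icc, integral_const_mul]
  by_cases hAB : A y < B y
  · rw [Set.indicator_of_mem (show y ∈ openFibers Q A B from ⟨hy, hAB⟩),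
      ← integral_Icc_fourierChar hτ hAB.le]
    ring
  · rw [Set.indicator_of_notMem (fun h : y ∈ openFibers Q A B => hAB h.2)]
    have : volume (Set.Icc (A y) (B y)) = 0 := by
      rw [Real.volume_Icc, ENNReal.ofReal_eq_zero]
      linarith
    rw [setIntegral_measure_zero _ this, mul_zero, mul_zero]

/-- The factor `τ` is absorbed by the oscillation along the fibres, so the Lipschitz constant in the
horizontal direction does not depend on `τ`. -/
theorem exists_expTransform_lipschitz (hS : IsSlab ι ξ H P Q A B) (hξ : ‖ξ‖ = 1)
    (hι : ∀ y, inner ℝ ξ (ι y) = (0 : ℝ))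
    (hmp : MeasurePreserving (fun p : EuclideanSpace ℝ (Fin n) × ℝ => ι p.1 + p.2 • ξ))
    (hPm : MeasurableSet P) (hP : Bornology.IsBounded P) :
    ∃ C, ∀ v (τ : ℝ), τ ≠ 0 →
      ‖2 * Real.pi * Complex.I * τ * expTransform P (ι v + τ • ξ) -
        2 * Real.pi * Complex.I * τ * expTransform P (τ • ξ)‖ ≤ C * ‖v‖ := by
  obtain ⟨R, hR⟩ := hP.subset_closedBall 0
  have hfin := hS.volume_openFibers_lt_top hξ hι hP
  have : IsFiniteMeasure (volume.restrict (openFibers Q A B)) := ⟨by simpa using hfin⟩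
  refine ⟨4 * Real.pi * R * volume.real (openFibers Q A B), fun v τ hτ => ?_⟩
  have h0 := hS.expTransform_eq hξ hι hmp hPm hP 0 hτ
  rw [map_zero, zero_add] at h0
  have hE : ∀ (g : EuclideanSpace ℝ (Fin n) → ℝ), Measurable g →
      Measurable fun y => (𝐞 (g y) : ℂ) := fun g hg => continuous_coe_fourierChar.measurable.comp hg
  have hint : ∀ v : EuclideanSpace ℝ (Fin n),
      IntegrableOn (fun y => (𝐞 (inner ℝ v y) : ℂ) * (𝐞 (τ * B y) - 𝐞 (τ * A y)))
        (openFibers Q A B) := fun v => by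
    refine Integrable.of_bound (C := 2) ?_ (ae_of_all _ fun y => ?_)
    · exact ((hE _ (by fun_prop)).mul ((hE _ (hS.measurable_upper.const_mul τ)).sub
        (hE _ (hS.measurable_lower.const_mul τ)))).aestronglyMeasurable
    · rw [norm_mul, Circle.norm_coe, one_mul]
      refine (norm_sub_le _ _).trans ?_
      rw [Circle.norm_coe, Circle.norm_coe]; norm_num
  rw [hS.expTransform_eq hξ hι hmp hPm hP v hτ, h0, ← integral_sub (hint v) (hint 0)]
  have hb : ∀ y ∈ openFibers Q A B,
      ‖(𝐞 (inner ℝ v y) : ℂ) * (𝐞 (τ * B y) - 𝐞 (τ * A y)) -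
        (𝐞 (inner ℝ 0 y) : ℂ) * (𝐞 (τ * B y) - 𝐞 (τ * A y))‖ ≤ 4 * Real.pi * R * ‖v‖ := by
    intro y hy
    have hyR : ‖y‖ ≤ R := mem_closedBall_zero_iff.1 (hS.openFibers_subset hξ hι hR hy)
    have hR0 : 0 ≤ R := (norm_nonneg y).trans hyR
    rw [← sub_mul, norm_mul, inner_zero_left, AddChar.map_zero_eq_one, Circle.coe_one]
    have h1 : ‖(𝐞 (τ * B y) - 𝐞 (τ * A y) : ℂ)‖ ≤ 2 := by
      refine (norm_sub_le _ _).trans ?_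
      rw [Circle.norm_coe, Circle.norm_coe]; norm_num
    have h2 : ‖(𝐞 (inner ℝ v y) : ℂ) - 1‖ ≤ 2 * Real.pi * (‖v‖ * R) :=
      (norm_fourierChar_sub_one_le _).trans (by
        gcongr
        exact (abs_real_inner_le_norm v y).trans (by gcongr))
    calc _ ≤ (2 * Real.pi * (‖v‖ * R)) * 2 := by gcongr
      _ = _ := by ring
  refine (norm_setIntegral_le_of_norm_le_const hfin hb).trans (le_of_eq ?_)
  ring

theorem tendsto_expTransform_sub_sum (hS : IsSlab ι ξ H P Q A B) (hξ : ‖ξ‖ = 1)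
    (hι : ∀ y, inner ℝ ξ (ι y) = (0 : ℝ))
    (hmp : MeasurePreserving (fun p : EuclideanSpace ℝ (Fin n) × ℝ => ι p.1 + p.2 • ξ))
    (hPm : MeasurableSet P) (hP : Bornology.IsBounded P) :
    Filter.Tendsto (fun τ : ℝ => 2 * Real.pi * Complex.I * τ * expTransform P (τ • ξ) -
      ∑ s ∈ orthogonalLevels ξ H, (slabJump Q A B s : ℂ) * 𝐞 (τ * s)) Filter.atTop (nhds 0) := by
  have hfin := hS.volume_openFibers_lt_top hξ hι hP
  have : IsFiniteMeasure (volume.restrict (openFibers Q A B)) := ⟨by simpa using hfin⟩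
  have hnull : ∀ {g : EuclideanSpace ℝ (Fin n) → ℝ},
      (∀ y, ∃ h ∈ H, inner ℝ h.1 ξ ≠ 0 ∧ g y = fiberRoot ι ξ h y) → ∀ N : Set ℝ, MeasurableSet N →
      volume N = 0 → (volume.restrict (openFibers Q A B))
        {y | g y ∈ N ∧ g y ∉ orthogonalLevels ξ H} = 0 := fun hg N _ hN =>
    le_antisymm ((Measure.restrict_apply_le _ _).trans
      (volume_setOf_mem_of_eq_fiberRoot hg hN).le) zero_le
  have hB := tendsto_integral_fourierChar_sub_sum (μ := volume.restrict (openFibers Q A B))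
    hS.measurable_upper (orthogonalLevels ξ H) (hnull hS.upper_eq)
  have hA := tendsto_integral_fourierChar_sub_sum (μ := volume.restrict (openFibers Q A B))
    hS.measurable_lower (orthogonalLevels ξ H) (hnull hS.lower_eq)
  have hsub := hB.sub hA
  rw [sub_zero] at hsub
  refine hsub.congr' ?_
  filter_upwards [Filter.eventually_ne_atTop 0] with τ hτ
  have h0 := hS.expTransform_eq hξ hι hmp hPm hP 0 hτ
  rw [map_zero, zero_add] at h0
  have hint : ∀ {g : EuclideanSpace ℝ (Fin n) → ℝ}, Measurable g →
      Integrable (fun y => (𝐞 (τ * g y) : ℂ)) (volume.restrict (openFibers Q A B)) := fun hg =>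
    Integrable.of_bound
      (continuous_coe_fourierChar.measurable.comp (hg.const_mul τ)).aestronglyMeasurable 1
      (ae_of_all _ fun y => (Circle.norm_coe _).le)
  have h1 : ∀ y, (𝐞 (inner ℝ (0 : EuclideanSpace ℝ (Fin n)) y) : ℂ) = 1 := fun y => by
    rw [inner_zero_left, AddChar.map_zero_eq_one, Circle.coe_one]
  simp only [h1, one_mul] at h0
  rw [h0, integral_sub (hint hS.measurable_upper) (hint hS.measurable_lower)]
  simp only [slabJump, Complex.ofReal_sub, sub_mul, Finset.sum_sub_distrib]
  ring

end IsSlab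

end Slicing

/-! ### The area of the faces with a given normal -/

section Faces

variable {d : ℕ} {Ω : Set (EuclideanSpace ℝ (Fin d))} {ν : EuclideanSpace ℝ (Fin d)}

/-- Near each of its points, `pointsWithNormal Ω ν` is the whole hyperplane orthogonal to `ν`. -/
theorem exists_pointsWithNormal_inter_ball (hν : ν ≠ 0) {x : EuclideanSpace ℝ (Fin d)}
    (hx : x ∈ pointsWithNormal Ω ν) :
    ∃ r > 0, pointsWithNormal Ω ν ∩ Metric.ball x r =
      {y | inner ℝ ν y = inner ℝ ν x} ∩ Metric.ball x r := by
  obtain ⟨r, hr, h⟩ := hx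
  refine ⟨r, hr, Set.ext fun y => and_congr_left fun hy => ⟨fun hyT => ?_, fun hyx => ?_⟩⟩
  · obtain ⟨ρ, hρ, h'⟩ := hyT
    have hyΩ : y ∈ Ω := (h' y (Metric.mem_ball_self hρ)).2 (by simp)
    have hle := (h y hy).1 hyΩ
    rw [inner_sub_right] at hle
    refine le_antisymm (by linarith) (not_lt.1 fun hlt => ?_)
    have hcont : Filter.Tendsto (fun t : ℝ => y + t • ν) (nhdsWithin 0 (Set.Ioi 0)) (nhds y) := by
      have : Continuous fun t : ℝ => y + t • ν := by fun_prop
      simpa using (this.tendsto 0).mono_left nhdsWithin_le_nhds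
    have h1 := hcont.eventually (Metric.ball_mem_nhds y hρ)
    have h2 := hcont.eventually (Metric.isOpen_ball.mem_nhds hy)
    have h3 := hcont.eventually ((isOpen_lt (f := fun z => inner ℝ ν z)
      (g := fun _ => inner ℝ ν x) (by fun_prop) (by fun_prop)).mem_nhds hlt)
    obtain ⟨t, ⟨⟨h1, h2⟩, h3⟩, ht⟩ := (((h1.and h2).and h3).and self_mem_nhdsWithin).exists
    have hin : y + t • ν ∈ Ω := (h _ h2).2 (by
      rw [inner_sub_right]
      exact sub_nonpos.2 (le_of_lt h3))
    have hle' := (h' _ h1).1 hin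
    rw [add_sub_cancel_left, inner_smul_right, real_inner_self_eq_norm_sq] at hle'
    have : 0 < t * ‖ν‖ ^ 2 := mul_pos ht (by positivity)
    linarith
  · have hyx' : inner ℝ ν y = (inner ℝ ν x : ℝ) := hyx
    refine ⟨r - dist y x, sub_pos.2 hy, fun z hz => ?_⟩
    have hzx : z ∈ Metric.ball x r := by
      rw [Metric.mem_ball] at hz ⊢
      linarith [dist_triangle z y x]
    rw [h z hzx, inner_sub_right, inner_sub_right, hyx']

theorem measurableSet_of_locally_eq_hyperplane {T : Set (EuclideanSpace ℝ (Fin d))}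
    (h : ∀ x ∈ T, ∃ r > 0, T ∩ Metric.ball x r =
      {y | inner ℝ ν y = inner ℝ ν x} ∩ Metric.ball x r) : MeasurableSet T := by
  choose! r hr h using h
  have hT : T = closure T ∩ ⋃ x ∈ T, Metric.ball x (r x) := by
    refine Set.Subset.antisymm (fun x hx => ⟨subset_closure hx,
      Set.mem_biUnion hx (Metric.mem_ball_self (hr x hx))⟩) ?_
    rintro y ⟨hy, hyU⟩
    obtain ⟨x, hx, hyx⟩ := Set.mem_iUnion₂.1 hyU
    have h1 : y ∈ closure (T ∩ Metric.ball x (r x)) :=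
      Metric.isOpen_ball.closure_inter ⟨hy, hyx⟩
    rw [h x hx] at h1
    have h2 : inner ℝ ν y = (inner ℝ ν x : ℝ) :=
      closure_minimal Set.inter_subset_left
        (isClosed_eq (f := fun z => inner ℝ ν z) (by fun_prop) continuous_const) h1
    have h3 : y ∈ T ∩ Metric.ball x (r x) := by
      rw [h x hx]; exact ⟨h2, hyx⟩
    exact h3.1
  rw [hT]
  exact isClosed_closure.measurableSet.inter
    (isOpen_biUnion fun _ _ => Metric.isOpen_ball).measurableSet

theorem connectedComponentIn_inter_ball (hν : ν ≠ 0) {x y : EuclideanSpace ℝ (Fin d)}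
    (hy : y ∈ connectedComponentIn (pointsWithNormal Ω ν) x) :
    ∃ r > 0, connectedComponentIn (pointsWithNormal Ω ν) x ∩ Metric.ball y r =
      pointsWithNormal Ω ν ∩ Metric.ball y r := by
  have hyT := connectedComponentIn_subset _ _ hy
  obtain ⟨r, hr, h⟩ := exists_pointsWithNormal_inter_ball hν hyT
  refine ⟨r, hr, Set.Subset.antisymm
    (Set.inter_subset_inter_left _ (connectedComponentIn_subset _ _)) fun z hz => ⟨?_, hz.2⟩⟩
  have hconv : Convex ℝ ({y' | inner ℝ ν y' = inner ℝ ν y} ∩ Metric.ball y r) :=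
    (convex_hyperplane (innerₗ _ ν).isLinear _).inter (convex_ball y r)
  rw [← h] at hconv
  rw [connectedComponentIn_eq hy]
  exact hconv.isPreconnected.subset_connectedComponentIn
    ⟨hyT, Metric.mem_ball_self hr⟩ Set.inter_subset_left hz

/-- The faces are relatively open in `pointsWithNormal Ω ν`, hence there are countably many of them,
and their areas add up to the area of their union. -/
theorem totalFaceArea_eq (hν : ν ≠ 0) :
    totalFaceArea Ω ν = μHE[d - 1] (pointsWithNormal Ω ν) := by
  have hrel : ∀ F ∈ facesWithNormal Ω ν,
      ∃ U, IsOpen U ∧ F = pointsWithNormal Ω ν ∩ U := by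
    rintro F ⟨x, hx, rfl⟩
    choose! r hr h using fun y hy => connectedComponentIn_inter_ball (Ω := Ω) hν (x := x) (y := y) hy
    refine ⟨⋃ y ∈ connectedComponentIn (pointsWithNormal Ω ν) x, Metric.ball y (r y),
      isOpen_biUnion fun _ _ => Metric.isOpen_ball, Set.Subset.antisymm (fun y hy =>
        ⟨connectedComponentIn_subset _ _ hy, Set.mem_biUnion hy (Metric.mem_ball_self (hr y hy))⟩)
        ?_⟩
    rintro z ⟨hz, hzU⟩
    obtain ⟨y, hy, hzy⟩ := Set.mem_iUnion₂.1 hzU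
    have hz' : z ∈ pointsWithNormal Ω ν ∩ Metric.ball y (r y) := ⟨hz, hzy⟩
    rw [← h y hy] at hz'
    exact hz'.1
  have hne : ∀ F ∈ facesWithNormal Ω ν, F.Nonempty := by
    rintro F ⟨x, hx, rfl⟩
    exact connectedComponentIn_nonempty_iff.2 hx
  have hsub : ∀ F ∈ facesWithNormal Ω ν, F ⊆ pointsWithNormal Ω ν := by
    rintro F ⟨x, hx, rfl⟩
    exact connectedComponentIn_subset _ _
  have hdisj : (facesWithNormal Ω ν).Pairwise Disjoint := by
    rintro F ⟨x, hx, rfl⟩ G ⟨y, hy, rfl⟩ hFG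
    refine Set.disjoint_left.2 fun z hz hz' => hFG ?_
    rw [connectedComponentIn_eq hz, connectedComponentIn_eq hz']
  have hmeasT : MeasurableSet (pointsWithNormal Ω ν) :=
    measurableSet_of_locally_eq_hyperplane (ν := ν)
      fun x hx => exists_pointsWithNormal_inter_ball hν hx
  have hcount : (facesWithNormal Ω ν).Countable := by
    refine Set.PairwiseDisjoint.countable_of_isOpen
      (s := fun F => ((↑) ⁻¹' F : Set (pointsWithNormal Ω ν))) ?_ ?_ ?_
    · exact fun F hF G hG hFG => (hdisj hF hG hFG).preimage _
    · intro F hF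
      obtain ⟨U, hU, hFU⟩ := hrel F hF
      refine ⟨U, hU, ?_⟩
      rw [hFU]; ext z; simp
    · intro F hF
      obtain ⟨z, hz⟩ := hne F hF
      exact ⟨⟨z, hsub F hF hz⟩, hz⟩
  have hU : ⋃₀ facesWithNormal Ω ν = pointsWithNormal Ω ν := by
    refine Set.Subset.antisymm (Set.sUnion_subset hsub) fun x hx => ?_
    exact ⟨_, ⟨x, hx, rfl⟩, mem_connectedComponentIn hx⟩
  rw [totalFaceArea, ← hU, measure_sUnion hcount hdisj]
  intro F hF
  obtain ⟨U, hU, hFU⟩ := hrel F hF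
  rw [hFU]
  exact hmeasT.inter hU.measurableSet

end Faces

section Jumps

variable {n : ℕ}

theorem euclideanHausdorffMeasure_eq_sum_slices
    {ι : EuclideanSpace ℝ (Fin n) →ₗᵢ[ℝ] EuclideanSpace ℝ (Fin (n + 1))}
    {ξ : EuclideanSpace ℝ (Fin (n + 1))} (hξ : ‖ξ‖ = 1) (hι : ∀ y, inner ℝ ξ (ι y) = (0 : ℝ))
    (hsurj : ∀ x, ∃ y, x = ι y + (inner ℝ ξ x : ℝ) • ξ)
    {T : Set (EuclideanSpace ℝ (Fin (n + 1)))} (hT : MeasurableSet T) {S : Finset ℝ}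
    (hTS : ∀ x ∈ T, inner ℝ ξ x ∈ S) :
    μHE[n] T = ∑ s ∈ S, volume {y | ι y + s • ξ ∈ T} := by
  have hiso : ∀ s : ℝ, Isometry fun y => ι y + s • ξ := fun s =>
    (isometry_add_right (s • ξ)).comp ι.isometry
  have himg : ∀ s : ℝ, (fun y => ι y + s • ξ) '' {y | ι y + s • ξ ∈ T} =
      T ∩ {x | inner ℝ ξ x = s} := by
    intro s
    ext x
    constructor
    · rintro ⟨y, hy, rfl⟩
      refine ⟨hy, ?_⟩
      change inner ℝ ξ (ι y + s • ξ) = s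
      rw [inner_add_right, hι, inner_smul_right, real_inner_self_eq_norm_sq, hξ]
      simp
    · rintro ⟨hx, hxs⟩
      obtain ⟨y, hy⟩ := hsurj x
      have hxs' : inner ℝ ξ x = s := hxs
      rw [hxs'] at hy
      exact ⟨y, show ι y + s • ξ ∈ T from hy ▸ hx, hy.symm⟩
  have hU : T = ⋃ s ∈ S, T ∩ {x | inner ℝ ξ x = s} := by
    ext x
    simp only [Set.mem_iUnion, Set.mem_inter_iff]
    exact ⟨fun hx => ⟨_, hTS x hx, hx, rfl⟩, fun ⟨s, _, hx, _⟩ => hx⟩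
  conv_lhs => rw [hU]
  rw [measure_biUnion_finset]
  · refine Finset.sum_congr rfl fun s _ => ?_
    rw [← himg, (hiso s).euclideanHausdorffMeasure_image,
      EuclideanSpace.euclideanHausdorffMeasure_eq_volume]
  · intro s _ t _ hst
    exact Set.disjoint_left.2 fun x hx hx' => hst (hx.2.symm.trans hx'.2)
  · intro s _
    exact hT.inter (measurableSet_eq_fun (f := fun x => inner ℝ ξ x)
      (by fun_prop) measurable_const)

/-! ### The local structure of a union of polyhedra at generic points -/

variable {ι : EuclideanSpace ℝ (Fin n) →ₗᵢ[ℝ] EuclideanSpace ℝ (Fin (n + 1))}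
  {ξ : EuclideanSpace ℝ (Fin (n + 1))}
  {H : Finset (EuclideanSpace ℝ (Fin (n + 1)) × ℝ)}

/-- The point `z` lies on no bounding hyperplane of a half-space of `H` except for hyperplanes
orthogonal to `ξ` (those whose normal vector is orthogonal to the range of `ι`). -/
def IsTransverselyGeneric (ι : EuclideanSpace ℝ (Fin n) →ₗᵢ[ℝ] EuclideanSpace ℝ (Fin (n + 1)))
    (H : Finset (EuclideanSpace ℝ (Fin (n + 1)) × ℝ)) (z : EuclideanSpace ℝ (Fin (n + 1))) :
    Prop :=
  ∀ h ∈ H, (∃ y, inner ℝ h.1 (ι y) ≠ (0 : ℝ)) → inner ℝ h.1 z ≠ h.2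

theorem ae_isTransverselyGeneric (s : ℝ) :
    ∀ᵐ y : EuclideanSpace ℝ (Fin n), IsTransverselyGeneric ι H (ι y + s • ξ) := by
  have h1 : ∀ h ∈ H, ∀ᵐ y : EuclideanSpace ℝ (Fin n),
      (∃ y, inner ℝ h.1 (ι y) ≠ (0 : ℝ)) → inner ℝ h.1 (ι y + s • ξ) ≠ h.2 := by
    intro h _
    by_cases hne : ∃ y, inner ℝ h.1 (ι y) ≠ (0 : ℝ)
    · have h0 := volume_setOf_inner_mem_eq_zero ι hne
        (N := {h.2 - s * inner ℝ h.1 ξ}) Real.volume_singleton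
      rw [ae_iff]
      refine measure_mono_null (fun y hy => ?_) h0
      have hy' : inner ℝ h.1 (ι y + s • ξ) = h.2 := by
        by_contra hc
        exact hy fun _ => hc
      rw [inner_add_right, inner_smul_right] at hy'
      change inner ℝ h.1 (ι y) = h.2 - s * inner ℝ h.1 ξ
      linarith
    · exact ae_of_all _ fun _ hc => absurd hc hne
  have h2 := (ae_ball_iff (Finset.countable_toSet H)).2 h1
  filter_upwards [h2] with y hy h hh hne
  exact hy h hh hne

theorem exists_eventually_halfSpace_iff_sign
    (hsurj : ∀ x, ∃ y, x = ι y + (inner ℝ ξ x : ℝ) • ξ) {z : EuclideanSpace ℝ (Fin (n + 1))}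
    (hz : IsTransverselyGeneric ι H z) {h : EuclideanSpace ℝ (Fin (n + 1)) × ℝ} (hh : h ∈ H) :
    ∃ p : SignType → Prop,
      (∀ᶠ x in 𝓝 z, (inner ℝ h.1 x ≤ h.2 ↔ p (SignType.sign (inner ℝ ξ x - inner ℝ ξ z)))) ∧
      (inner ℝ ξ z ∉ orthogonalLevels ξ H → ∀ σ σ', p σ ↔ p σ') := by
  have hc1 : Continuous fun x => (inner ℝ h.1 x : ℝ) := by fun_prop
  rcases lt_trichotomy (inner ℝ h.1 z) h.2 with hlt | heq | hgt
  · refine ⟨fun _ => True, ?_, fun _ _ _ => Iff.rfl⟩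
    filter_upwards [(isOpen_lt hc1 continuous_const).mem_nhds hlt] with x hx
    exact iff_true_intro (le_of_lt hx)
  · have hker : ∀ y, inner ℝ h.1 (ι y) = (0 : ℝ) := by
      by_contra! hne
      exact hz h hh hne heq
    have hx : ∀ x, inner ℝ h.1 x = inner ℝ ξ x * (inner ℝ h.1 ξ : ℝ) := fun x => by
      obtain ⟨y, hy⟩ := hsurj x
      conv_lhs => rw [hy, inner_add_right, hker, inner_smul_right, zero_add]
    have hx' : ∀ x, (inner ℝ h.1 x ≤ h.2 ↔
        (inner ℝ ξ x - inner ℝ ξ z) * (inner ℝ h.1 ξ : ℝ) ≤ 0) := fun x => by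
      rw [← heq, hx x, hx z, sub_mul, sub_nonpos]
    rcases lt_trichotomy (inner ℝ h.1 ξ : ℝ) 0 with hneg | h0 | hpos
    · refine ⟨fun σ => 0 ≤ σ, Eventually.of_forall fun x => ?_, fun hS => ?_⟩
      · change _ ↔ 0 ≤ SignType.sign _
        rw [hx', sign_nonneg_iff]
        constructor
        · intro hle; by_contra! hc; nlinarith
        · intro hle; nlinarith
      · refine absurd (Finset.mem_image.2 ⟨h, hh, ?_⟩) hS
        rw [← heq, hx z, mul_div_cancel_right₀ _ hneg.ne]
    · refine ⟨fun _ => True, Eventually.of_forall fun x => ?_, fun _ _ _ => Iff.rfl⟩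
      rw [hx', h0, mul_zero]
      simp
    · refine ⟨fun σ => σ ≤ 0, Eventually.of_forall fun x => ?_, fun hS => ?_⟩
      · change _ ↔ SignType.sign _ ≤ 0
        rw [hx', sign_nonpos_iff]
        constructor
        · intro hle; by_contra! hc; nlinarith
        · intro hle; nlinarith
      · refine absurd (Finset.mem_image.2 ⟨h, hh, ?_⟩) hS
        rw [← heq, hx z, mul_div_cancel_right₀ _ hpos.ne']
  · refine ⟨fun _ => False, ?_, fun _ _ _ => Iff.rfl⟩
    filter_upwards [(isOpen_lt continuous_const hc1).mem_nhds hgt] with x hx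
    exact iff_false_intro (not_le_of_gt hx)

/-- Near a generic point `z`, membership in a union of polyhedra depends only on whether a point lies
above, below, or at the height of `z`; and not even on this if `z` is at none of the orthogonal
levels. -/
theorem exists_eventually_mem_iff_sign
    (hsurj : ∀ x, ∃ y, x = ι y + (inner ℝ ξ x : ℝ) • ξ) {z : EuclideanSpace ℝ (Fin (n + 1))}
    (hz : IsTransverselyGeneric ι H z) {𝒯 : Finset (Finset (EuclideanSpace ℝ (Fin (n + 1)) × ℝ))}
    (h𝒯 : ∀ K ∈ 𝒯, K ⊆ H) :
    ∃ p : SignType → Prop,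
      (∀ᶠ x in 𝓝 z, (x ∈ ⋃ K ∈ 𝒯, polyhedron K ↔
        p (SignType.sign (inner ℝ ξ x - inner ℝ ξ z)))) ∧
      (inner ℝ ξ z ∉ orthogonalLevels ξ H → ∀ σ σ', p σ ↔ p σ') := by
  choose! p hp hp' using fun h (hh : h ∈ H) =>
    exists_eventually_halfSpace_iff_sign hsurj hz hh
  refine ⟨fun σ => ∃ K ∈ 𝒯, ∀ h ∈ K, p h σ, ?_, fun hS σ σ' => ?_⟩
  · filter_upwards [(Filter.eventually_all_finset H).2 hp] with x hx
    simp only [Set.mem_iUnion, polyhedron, Set.mem_ofPred_eq, exists_prop]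
    exact exists_congr fun K => and_congr_right fun hK => forall₂_congr fun h hh =>
      hx h (h𝒯 K hK hh)
  · exact exists_congr fun K => and_congr_right fun hK => forall₂_congr fun h hh =>
      hp' h (h𝒯 K hK hh) hS σ σ'

section LocalJump

variable {Ω : Set (EuclideanSpace ℝ (Fin (n + 1)))}
  {z : EuclideanSpace ℝ (Fin (n + 1))} {p : SignType → Prop}

theorem tendsto_add_smul_nhdsGT (z v : EuclideanSpace ℝ (Fin (n + 1))) :
    Tendsto (fun t : ℝ => z + t • v) (𝓝[>] 0) (𝓝 z) := by
  have : Continuous fun t : ℝ => z + t • v := by fun_prop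
  simpa using (this.tendsto 0).mono_left nhdsWithin_le_nhds

theorem sign_inner_add_smul_sub (hξ : ‖ξ‖ = 1) (z : EuclideanSpace ℝ (Fin (n + 1))) (t : ℝ) :
    SignType.sign (inner ℝ ξ (z + t • ξ) - inner ℝ ξ z : ℝ) = SignType.sign t := by
  rw [inner_add_right, inner_smul_right, real_inner_self_eq_norm_sq, hξ]
  congr 1
  ring

theorem eventually_sub_smul_mem_iff (hξ : ‖ξ‖ = 1)
    (hp : ∀ᶠ x in 𝓝 z, (x ∈ Ω ↔ p (SignType.sign (inner ℝ ξ x - inner ℝ ξ z)))) :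
    ∀ᶠ t : ℝ in 𝓝[>] 0, (z - t • ξ ∈ Ω ↔ p (-1)) := by
  have h := (tendsto_add_smul_nhdsGT z (-ξ)).eventually hp
  filter_upwards [h, self_mem_nhdsWithin] with t ht ht0
  rw [smul_neg, ← sub_eq_add_neg] at ht
  have he : z - t • ξ = z + (-t) • ξ := by rw [neg_smul, sub_eq_add_neg]
  rw [ht, he, sign_inner_add_smul_sub hξ, sign_neg (neg_lt_zero.2 ht0)]

theorem eventually_add_smul_mem_iff (hξ : ‖ξ‖ = 1)
    (hp : ∀ᶠ x in 𝓝 z, (x ∈ Ω ↔ p (SignType.sign (inner ℝ ξ x - inner ℝ ξ z)))) :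
    ∀ᶠ t : ℝ in 𝓝[>] 0, (z + t • ξ ∈ Ω ↔ p 1) := by
  have h := (tendsto_add_smul_nhdsGT z ξ).eventually hp
  filter_upwards [h, self_mem_nhdsWithin] with t ht ht0
  rw [ht, sign_inner_add_smul_sub hξ, sign_pos ht0]

theorem mem_of_eventually_add_smul_mem (hΩ : IsClosed Ω) {v : EuclideanSpace ℝ (Fin (n + 1))}
    (h : ∀ᶠ t : ℝ in 𝓝[>] 0, z + t • v ∈ Ω) : z ∈ Ω :=
  hΩ.mem_of_tendsto (tendsto_add_smul_nhdsGT z v) h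

/-- If membership in `Ω` near `z` depends only on the side `p` of the horizontal hyperplane through
`z`, then `z` is a boundary point with normal `ξ` iff `Ω` contains the lower side but not the upper
one. For the hyperplane itself, closedness of `Ω` decides. -/
theorem mem_pointsWithNormal_iff (hξ : ‖ξ‖ = 1) (hΩ : IsClosed Ω)
    (hp : ∀ᶠ x in 𝓝 z, (x ∈ Ω ↔ p (SignType.sign (inner ℝ ξ x - inner ℝ ξ z)))) :
    z ∈ pointsWithNormal Ω ξ ↔ p (-1) ∧ ¬ p 1 := by
  have hz := hp.self_of_nhds
  rw [sub_self, sign_zero] at hz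
  constructor
  · rintro ⟨r, hr, h⟩
    have hb : ∀ᶠ x in 𝓝 z, (x ∈ Ω ↔ inner ℝ ξ (x - z) ≤ 0) := by
      filter_upwards [Metric.ball_mem_nhds z hr] with x hx using h x hx
    have hb' : ∀ᶠ x in 𝓝 z, (x ∈ Ω ↔ SignType.sign (inner ℝ ξ x - inner ℝ ξ z : ℝ) ≤ 0) := by
      filter_upwards [hb] with x hx
      rw [hx, inner_sub_right, sign_nonpos_iff]
    obtain ⟨t, ht, ht'⟩ := ((eventually_sub_smul_mem_iff hξ hp).and
      (eventually_sub_smul_mem_iff hξ (p := fun σ => σ ≤ 0) hb')).exists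
    obtain ⟨u, hu, hu'⟩ := ((eventually_add_smul_mem_iff hξ hp).and
      (eventually_add_smul_mem_iff hξ (p := fun σ => σ ≤ 0) hb')).exists
    exact ⟨ht.1 (ht'.2 (by decide)), fun h1 => absurd (hu'.1 (hu.2 h1)) (by decide)⟩
  · rintro ⟨h1, h2⟩
    have h0 : z ∈ Ω := by
      refine mem_of_eventually_add_smul_mem hΩ (v := -ξ) ?_
      filter_upwards [eventually_sub_smul_mem_iff hξ hp] with t ht
      rw [smul_neg, ← sub_eq_add_neg]
      exact ht.2 h1
    obtain ⟨r, hr, h⟩ := Metric.eventually_nhds_iff_ball.1 hp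
    refine ⟨r, hr, fun x hx => ?_⟩
    rw [h x hx, inner_sub_right, ← sign_nonpos_iff]
    rcases hs : SignType.sign (inner ℝ ξ x - inner ℝ ξ z : ℝ) with _ | _ | _
    · exact iff_of_true (hz.1 h0) le_rfl
    · exact iff_of_true h1 (by decide)
    · exact iff_of_false h2 (by decide)

theorem mem_pointsWithNormal_neg_iff (hξ : ‖ξ‖ = 1) (hΩ : IsClosed Ω)
    (hp : ∀ᶠ x in 𝓝 z, (x ∈ Ω ↔ p (SignType.sign (inner ℝ ξ x - inner ℝ ξ z)))) :
    z ∈ pointsWithNormal Ω (-ξ) ↔ p 1 ∧ ¬ p (-1) := by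
  have hp' : ∀ᶠ x in 𝓝 z, (x ∈ Ω ↔
      p (-SignType.sign (inner ℝ (-ξ) x - inner ℝ (-ξ) z))) := by
    filter_upwards [hp] with x hx
    rw [hx, inner_neg_left, inner_neg_left, ← Left.sign_neg]
    congr! 2
    ring
  have := mem_pointsWithNormal_iff (ξ := -ξ) (p := fun σ => p (-σ)) (by rwa [norm_neg]) hΩ hp'
  simpa using this

end LocalJump

/-- The faces orthogonal to `ξ` lie at the orthogonal levels: a face contains generic points, and at
another height the set would be locally everything or nothing there. -/
theorem inner_mem_orthogonalLevels (hξ : ‖ξ‖ = 1) (hι : ∀ y, inner ℝ ξ (ι y) = (0 : ℝ))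
    (hsurj : ∀ x, ∃ y, x = ι y + (inner ℝ ξ x : ℝ) • ξ)
    {𝒯 : Finset (Finset (EuclideanSpace ℝ (Fin (n + 1)) × ℝ))}
    (h𝒯 : ∀ K ∈ 𝒯, K ⊆ H) {ν : EuclideanSpace ℝ (Fin (n + 1))} (hν : ν = ξ ∨ ν = -ξ)
    {x : EuclideanSpace ℝ (Fin (n + 1))}
    (hx : x ∈ pointsWithNormal (⋃ K ∈ 𝒯, polyhedron K) ν) :
    inner ℝ ξ x ∈ orthogonalLevels ξ H := by
  have hξ0 : ξ ≠ 0 := fun h => by simp [h] at hξ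
  have hν0 : ν ≠ 0 := by rcases hν with rfl | rfl <;> simpa
  have hclosed : IsClosed (⋃ K ∈ 𝒯, polyhedron K) :=
    Set.Finite.isClosed_biUnion (Finset.finite_toSet 𝒯) fun K _ => isClosed_polyhedron K
  obtain ⟨r, hr, hball⟩ := exists_pointsWithNormal_inter_ball hν0 hx
  obtain ⟨y₀, hy₀⟩ := hsurj x
  set s : ℝ := inner ℝ ξ x with hs
  -- a generic point of the face, close to `x`
  obtain ⟨y, hy, hgen⟩ : ∃ y ∈ Metric.ball y₀ r, IsTransverselyGeneric ι H (ι y + s • ξ) := by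
    by_contra! hc
    have h0 : volume (Metric.ball y₀ r) = 0 :=
      measure_mono_null (fun y hy => hc y hy) (ae_iff.1 (ae_isTransverselyGeneric (ι := ι) (H := H)
        (ξ := ξ) s))
    exact (Metric.measure_ball_pos volume y₀ hr).ne' h0
  have hinner : inner ℝ ξ (ι y + s • ξ) = s := by
    rw [inner_add_right, hι, inner_smul_right, real_inner_self_eq_norm_sq, hξ]
    simp
  have hmem : ι y + s • ξ ∈ pointsWithNormal (⋃ K ∈ 𝒯, polyhedron K) ν := by
    have : ι y + s • ξ ∈ {y | inner ℝ ν y = inner ℝ ν x} ∩ Metric.ball x r := by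
      refine ⟨?_, ?_⟩
      · change inner ℝ ν (ι y + s • ξ) = inner ℝ ν x
        rcases hν with rfl | rfl
        · rw [hinner]
        · rw [inner_neg_left, inner_neg_left, hinner]
      · rw [Metric.mem_ball, hy₀, dist_add_right, ι.isometry.dist_eq]
        exact hy
    rw [← hball] at this
    exact this.1
  obtain ⟨p, hp, hconst⟩ := exists_eventually_mem_iff_sign hsurj hgen h𝒯
  by_contra hS
  rw [hinner] at hconst
  have hc := hconst hS 1 (-1)
  rcases hν with rfl | rfl
  · have := (mem_pointsWithNormal_iff hξ hclosed hp).1 hmem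
    exact this.2 (hc.2 this.1)
  · have := (mem_pointsWithNormal_neg_iff hξ hclosed hp).1 hmem
    exact this.2 (hc.1 this.1)

/-! ### Decomposition of a polytope into convex polyhedra -/

section Decomposition

variable {d : ℕ}

/-- The half-spaces with normals `ξ` and `-ξ` do not change the polyhedra; they make each of them a
slab over the hyperplane orthogonal to `ξ`. -/
theorem IsPolytope.exists_polyhedra {Ω : Set (EuclideanSpace ℝ (Fin d))} (hΩ : IsPolytope Ω)
    {ξ : EuclideanSpace ℝ (Fin d)} (hξ : ‖ξ‖ = 1) :
    ∃ (𝒯 : Finset (Finset (EuclideanSpace ℝ (Fin d) × ℝ))) (R : ℝ),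
      Ω = ⋃ K ∈ 𝒯, polyhedron K ∧
      ∀ K ∈ 𝒯, Bornology.IsBounded (polyhedron K) ∧ (ξ, R) ∈ K ∧ (-ξ, R) ∈ K := by
  classical
  obtain ⟨C, hC, hconv, rfl⟩ := hΩ
  choose! hb _ G hG using hconv
  obtain ⟨R, hR⟩ := ((Bornology.isBounded_sUnion hC).2 hb).subset_closedBall 0
  have hpoly : ∀ P ∈ C, polyhedron (insert (ξ, R) (insert (-ξ, R) (G P))) = P := by
    intro P hP
    ext x
    simp only [polyhedron, Finset.forall_mem_insert, Set.mem_ofPred_eq]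
    constructor
    · rintro ⟨_, _, h⟩
      rw [hG P hP]
      exact h
    · intro hx
      have hxR : ‖x‖ ≤ R := mem_closedBall_zero_iff.1 (hR (Set.mem_sUnion_of_mem hx hP))
      have h1 : |inner ℝ ξ x| ≤ R :=
        (abs_real_inner_le_norm ξ x).trans (by rw [hξ, one_mul]; exact hxR)
      refine ⟨(abs_le.1 h1).2, ?_, ?_⟩
      · rw [inner_neg_left]
        linarith [(abs_le.1 h1).1]
      · rw [hG P hP] at hx
        exact hx
  refine ⟨hC.toFinset.image fun P => insert (ξ, R) (insert (-ξ, R) (G P)), R, ?_, ?_⟩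
  · rw [Finset.set_biUnion_finset_image, Set.sUnion_eq_biUnion]
    simp only [Set.Finite.mem_toFinset]
    exact (Set.iUnion₂_congr hpoly).symm
  · intro K hK
    obtain ⟨P, hP, rfl⟩ := Finset.mem_image.1 hK
    rw [hC.mem_toFinset] at hP
    rw [hpoly P hP]
    exact ⟨hb P hP, by simp, by simp⟩

theorem polyhedron_anti {K L : Finset (EuclideanSpace ℝ (Fin d) × ℝ)} (h : K ⊆ L) :
    polyhedron L ⊆ polyhedron K :=
  fun _ hx k hk => hx k (h hk)

open scoped Classical in
/-- Inclusion-exclusion: an intersection of polyhedra is again a polyhedron. -/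
theorem indicator_biUnion_polyhedron (𝒯 : Finset (Finset (EuclideanSpace ℝ (Fin d) × ℝ)))
    (x : EuclideanSpace ℝ (Fin d)) :
    (⋃ K ∈ 𝒯, polyhedron K).indicator (fun _ => (1 : ℝ)) x =
      ∑ T ∈ 𝒯.powerset.erase ∅,
        (-1) ^ (T.card + 1) * (polyhedron (T.biUnion id)).indicator (fun _ => (1 : ℝ)) x := by
  have h1 : ∀ T : Finset (Finset (EuclideanSpace ℝ (Fin d) × ℝ)),
      ∏ K ∈ T, (polyhedron K).indicator (fun _ => (1 : ℝ)) x =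
        (polyhedron (T.biUnion id)).indicator (fun _ => (1 : ℝ)) x := by
    intro T
    by_cases hx : x ∈ polyhedron (T.biUnion id)
    · rw [Set.indicator_of_mem hx]
      refine Finset.prod_eq_one fun K hK => Set.indicator_of_mem ?_ _
      exact polyhedron_anti (Finset.subset_biUnion_of_mem id hK) hx
    · rw [Set.indicator_of_notMem hx]
      simp only [polyhedron, Finset.mem_biUnion, id, Set.mem_ofPred_eq, not_forall] at hx
      obtain ⟨h, ⟨K, hK, hhK⟩, hne⟩ := hx
      exact Finset.prod_eq_zero hK (Set.indicator_of_notMem (fun hxK : x ∈ polyhedron K => hne (hxK h hhK)) _)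
  have h2 : 1 - (⋃ K ∈ 𝒯, polyhedron K).indicator (fun _ => (1 : ℝ)) x =
      ∏ K ∈ 𝒯, (1 - (polyhedron K).indicator (fun _ => (1 : ℝ)) x) := by
    by_cases hx : x ∈ ⋃ K ∈ 𝒯, polyhedron K
    · obtain ⟨K, hK, hxK⟩ := Set.mem_iUnion₂.1 hx
      rw [Set.indicator_of_mem hx, sub_self]
      exact (Finset.prod_eq_zero hK (by rw [Set.indicator_of_mem hxK, sub_self])).symm
    · rw [Set.indicator_of_notMem hx, sub_zero]
      refine (Finset.prod_eq_one fun K hK => ?_).symm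
      rw [Set.indicator_of_notMem (fun hxK => hx (Set.mem_biUnion hK hxK)), sub_zero]
  rw [Finset.prod_sub] at h2
  simp only [Finset.prod_const_one, mul_one, h1] at h2
  rw [← Finset.add_sum_erase _ _ (Finset.empty_mem_powerset 𝒯)] at h2
  simp only [Finset.card_empty, pow_zero, one_mul, Finset.biUnion_empty] at h2
  have h3 : (polyhedron (∅ : Finset (EuclideanSpace ℝ (Fin d) × ℝ))).indicator
      (fun _ => (1 : ℝ)) x = 1 := Set.indicator_of_mem (by simp [polyhedron]) _
  rw [h3] at h2
  simp only [pow_succ, mul_neg, mul_one, neg_mul, Finset.sum_neg_distrib]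
  linarith

theorem expTransform_eq_sum {κ : Type*} {I : Finset κ} {c : κ → ℝ}
    {Ω : Set (EuclideanSpace ℝ (Fin d))} {P : κ → Set (EuclideanSpace ℝ (Fin d))}
    (hΩ : MeasurableSet Ω) (hP : ∀ k ∈ I, MeasurableSet (P k))
    (hPfin : ∀ k ∈ I, volume (P k) ≠ ⊤)
    (h : ∀ x, Ω.indicator (fun _ => (1 : ℝ)) x =
      ∑ k ∈ I, c k * (P k).indicator (fun _ => (1 : ℝ)) x) (η : EuclideanSpace ℝ (Fin d)) :
    expTransform Ω η = ∑ k ∈ I, (c k : ℂ) * expTransform (P k) η := by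
  have hind : ∀ (A : Set (EuclideanSpace ℝ (Fin d))) x, A.indicator (expFun η) x =
      ((A.indicator (fun _ => (1 : ℝ)) x : ℝ) : ℂ) * expFun η x := fun A x => by
    by_cases hx : x ∈ A <;> simp [hx]
  have hint : ∀ k ∈ I, Integrable ((P k).indicator (expFun η)) := fun k hk => by
    rw [integrable_indicator_iff (hP k hk)]
    have : IsFiniteMeasure (volume.restrict (P k)) := ⟨by simpa using (hPfin k hk).lt_top⟩
    exact Integrable.of_bound (continuous_expFun _).aestronglyMeasurable 1
      (ae_of_all _ fun x => (norm_expFun _ x).le)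
  have hsum : ∀ k ∈ I, (c k : ℂ) * expTransform (P k) η =
      ∫ x, (c k : ℂ) * (P k).indicator (expFun η) x := fun k hk => by
    rw [integral_const_mul, integral_indicator (hP k hk)]
    rfl
  rw [Finset.sum_congr rfl hsum, ← integral_finsetSum I fun k hk => (hint k hk).const_mul _,
    expTransform, ← integral_indicator hΩ]
  congr 1 with x
  rw [hind, h x]
  simp only [hind, Complex.ofReal_sum, Complex.ofReal_mul, Finset.sum_mul, mul_assoc]

end Decomposition

/-! ### Jumps along the fibres and the signed face area -/

/-- The jump of the indicator of a slab along the fibre, from just below the height `s` to just above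
it. Degenerate fibres do not contribute. -/
theorem IsSlab.eventually_indicator_sub {P : Set (EuclideanSpace ℝ (Fin (n + 1)))}
    {Q : Set (EuclideanSpace ℝ (Fin n))} {A B : EuclideanSpace ℝ (Fin n) → ℝ}
    (hS : IsSlab ι ξ H P Q A B) (y : EuclideanSpace ℝ (Fin n)) (s : ℝ) :
    ∀ᶠ t : ℝ in 𝓝[>] 0, P.indicator (fun _ => (1 : ℝ)) (ι y + s • ξ - t • ξ) -
        P.indicator (fun _ => (1 : ℝ)) (ι y + s • ξ + t • ξ) =
      ({y | B y = s} ∩ openFibers Q A B).indicator (fun _ => (1 : ℝ)) y -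
        ({y | A y = s} ∩ openFibers Q A B).indicator (fun _ => (1 : ℝ)) y := by
  have hle : ∀ a : ℝ, ∀ᶠ t : ℝ in 𝓝[>] 0, (t ≤ a ↔ 0 < a) := by
    intro a
    rcases lt_or_ge 0 a with ha | ha
    · filter_upwards [Ioc_mem_nhdsGT ha] with t ht
      exact iff_of_true ht.2 ha
    · filter_upwards [self_mem_nhdsWithin] with t ht
      exact iff_of_false (not_le.2 (ha.trans_lt ht)) (not_lt.2 ha)
  have hlt : ∀ a : ℝ, ∀ᶠ t : ℝ in 𝓝[>] 0, (t < a ↔ 0 < a) := by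
    intro a
    rcases lt_or_ge 0 a with ha | ha
    · filter_upwards [Ioo_mem_nhdsGT ha] with t ht
      exact iff_of_true ht.2 ha
    · filter_upwards [self_mem_nhdsWithin] with t ht
      exact iff_of_false (not_lt.2 (ha.trans (le_of_lt ht))) (not_lt.2 ha)
  filter_upwards [hle (s - A y), hlt (s - B y), hlt (A y - s), hle (B y - s)] with t h1 h2 h3 h4
  have hm : ι y + s • ξ - t • ξ ∈ P ↔ y ∈ Q ∧ A y < s ∧ s ≤ B y := by
    rw [add_sub_assoc, ← sub_smul, hS.mem_iff, le_sub_comm, h1, sub_pos, sub_le_comm, ← not_lt, h2,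
      sub_pos, not_lt]
  have hp : ι y + s • ξ + t • ξ ∈ P ↔ y ∈ Q ∧ A y ≤ s ∧ s < B y := by
    rw [add_assoc, ← add_smul, hS.mem_iff, ← sub_le_iff_le_add', ← not_lt, h3, sub_pos, not_lt,
      ← le_sub_iff_add_le', h4, sub_pos]
  have hB : y ∈ {y | B y = s} ∩ openFibers Q A B ↔ B y = s ∧ y ∈ Q ∧ A y < B y := Iff.rfl
  have hA : y ∈ {y | A y = s} ∩ openFibers Q A B ↔ A y = s ∧ y ∈ Q ∧ A y < B y := Iff.rfl
  classical
  simp only [Set.indicator_apply, hm, hp, hA, hB]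
  by_cases hQ : y ∈ Q
  swap
  · simp [hQ]
  simp only [hQ, true_and]
  split_ifs <;> grind

theorem pointsWithNormal_subset {d : ℕ} (Ω : Set (EuclideanSpace ℝ (Fin d)))
    (ν : EuclideanSpace ℝ (Fin d)) : pointsWithNormal Ω ν ⊆ Ω := by
  rintro x ⟨r, hr, h⟩
  exact (h x (Metric.mem_ball_self hr)).2 (by simp)

theorem measurableSet_pointsWithNormal {d : ℕ} (Ω : Set (EuclideanSpace ℝ (Fin d)))
    {ν : EuclideanSpace ℝ (Fin d)} (hν : ν ≠ 0) : MeasurableSet (pointsWithNormal Ω ν) :=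
  measurableSet_of_locally_eq_hyperplane (ν := ν)
    fun _ hx => exists_pointsWithNormal_inter_ball hν hx

theorem volume_slice_lt_top (hξ : ‖ξ‖ = 1) (hι : ∀ y, inner ℝ ξ (ι y) = (0 : ℝ))
    {T : Set (EuclideanSpace ℝ (Fin (n + 1)))} (hT : Bornology.IsBounded T) (s : ℝ) :
    volume {y | ι y + s • ξ ∈ T} < ⊤ := by
  obtain ⟨R, hR⟩ := hT.subset_closedBall 0
  refine (measure_mono (t := Metric.closedBall 0 R) fun y hy => ?_).trans_lt
    measure_closedBall_lt_top
  have h1 : ‖ι y + s • ξ‖ ≤ R := mem_closedBall_zero_iff.1 (hR hy)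
  rw [mem_closedBall_zero_iff]
  refine le_trans (le_of_sq_le_sq ?_ (norm_nonneg _)) h1
  rw [norm_slicing_sq hξ hι]
  nlinarith [sq_nonneg s]

theorem signedFaceArea_eq_sum_slices (hξ : ‖ξ‖ = 1) (hι : ∀ y, inner ℝ ξ (ι y) = (0 : ℝ))
    (hsurj : ∀ x, ∃ y, x = ι y + (inner ℝ ξ x : ℝ) • ξ)
    {𝒯 : Finset (Finset (EuclideanSpace ℝ (Fin (n + 1)) × ℝ))} (h𝒯 : ∀ K ∈ 𝒯, K ⊆ H)
    (hb : Bornology.IsBounded (⋃ K ∈ 𝒯, polyhedron K)) :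
    signedFaceArea (⋃ K ∈ 𝒯, polyhedron K) ξ = ∑ s ∈ orthogonalLevels ξ H,
      (volume.real {y | ι y + s • ξ ∈ pointsWithNormal (⋃ K ∈ 𝒯, polyhedron K) ξ} -
        volume.real {y | ι y + s • ξ ∈ pointsWithNormal (⋃ K ∈ 𝒯, polyhedron K) (-ξ)}) := by
  have hξ0 : ξ ≠ 0 := fun h => by simp [h] at hξ
  have key : ∀ ν, ν = ξ ∨ ν = -ξ → (totalFaceArea (⋃ K ∈ 𝒯, polyhedron K) ν).toReal =
      ∑ s ∈ orthogonalLevels ξ H,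
        volume.real {y | ι y + s • ξ ∈ pointsWithNormal (⋃ K ∈ 𝒯, polyhedron K) ν} := by
    intro ν hν
    have hν0 : ν ≠ 0 := by rcases hν with rfl | rfl <;> simpa
    rw [totalFaceArea_eq hν0]
    change (μHE[n] (pointsWithNormal _ ν)).toReal = _
    rw [euclideanHausdorffMeasure_eq_sum_slices hξ hι hsurj (measurableSet_pointsWithNormal _ hν0)
      fun x hx => inner_mem_orthogonalLevels hξ hι hsurj h𝒯 hν hx, ENNReal.toReal_sum]
    · rfl
    · intro s _
      exact (volume_slice_lt_top hξ hι (hb.subset (pointsWithNormal_subset _ ν)) s).ne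
  rw [signedFaceArea, key ξ (Or.inl rfl), key (-ξ) (Or.inr rfl), Finset.sum_sub_distrib]

/-- The signed area at height `s` of the faces of `Ω` orthogonal to `ξ` is the combination of the
jumps of the slabs into which `Ω` decomposes: above almost every `y`, both are the jump at `s` of the
indicator of `Ω` along the fibre. -/
theorem volume_slices_sub_eq_sum_slabJump (hξ : ‖ξ‖ = 1)
    (hι : ∀ y, inner ℝ ξ (ι y) = (0 : ℝ))
    (hsurj : ∀ x, ∃ y, x = ι y + (inner ℝ ξ x : ℝ) • ξ)
    {𝒯 : Finset (Finset (EuclideanSpace ℝ (Fin (n + 1)) × ℝ))} (h𝒯 : ∀ K ∈ 𝒯, K ⊆ H)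
    (hb : Bornology.IsBounded (⋃ K ∈ 𝒯, polyhedron K))
    {κ : Type*} {I : Finset κ} {c : κ → ℝ} {P : κ → Set (EuclideanSpace ℝ (Fin (n + 1)))}
    {Q : κ → Set (EuclideanSpace ℝ (Fin n))} {A B : κ → EuclideanSpace ℝ (Fin n) → ℝ}
    (hS : ∀ k ∈ I, IsSlab ι ξ H (P k) (Q k) (A k) (B k))
    (hPb : ∀ k ∈ I, Bornology.IsBounded (P k))
    (hsum : ∀ x, (⋃ K ∈ 𝒯, polyhedron K).indicator (fun _ => (1 : ℝ)) x =
      ∑ k ∈ I, c k * (P k).indicator (fun _ => (1 : ℝ)) x) (s : ℝ) :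
    volume.real {y | ι y + s • ξ ∈ pointsWithNormal (⋃ K ∈ 𝒯, polyhedron K) ξ} -
        volume.real {y | ι y + s • ξ ∈ pointsWithNormal (⋃ K ∈ 𝒯, polyhedron K) (-ξ)} =
      ∑ k ∈ I, c k * slabJump (Q k) (A k) (B k) s := by
  have hξ0 : ξ ≠ 0 := fun h => by simp [h] at hξ
  set Ω := ⋃ K ∈ 𝒯, polyhedron K with hΩ
  have hclosed : IsClosed Ω :=
    Set.Finite.isClosed_biUnion (Finset.finite_toSet 𝒯) fun K _ => isClosed_polyhedron K
  have hcont : Continuous fun y => ι y + s • ξ := ι.continuous.add continuous_const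
  have hmeas : ∀ ν, ν ≠ 0 → MeasurableSet {y | ι y + s • ξ ∈ pointsWithNormal Ω ν} := fun ν hν =>
    hcont.measurable (measurableSet_pointsWithNormal Ω hν)
  have hint : ∀ {E : Set (EuclideanSpace ℝ (Fin n))}, MeasurableSet E → volume E < ⊤ →
      Integrable (E.indicator fun _ => (1 : ℝ)) := fun hE hfin =>
    (integrable_indicator_iff hE).2 (integrableOn_const hfin.ne)
  have hreal : ∀ {E : Set (EuclideanSpace ℝ (Fin n))}, MeasurableSet E →
      volume.real E = ∫ y, E.indicator (fun _ => (1 : ℝ)) y := fun hE => by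
    rw [integral_indicator hE]
    simp
  have hfin : ∀ ν, volume {y | ι y + s • ξ ∈ pointsWithNormal Ω ν} < ⊤ := fun ν =>
    volume_slice_lt_top hξ hι (hb.subset (pointsWithNormal_subset _ ν)) s
  have hξ0' : -ξ ≠ 0 := neg_ne_zero.2 hξ0
  have hBs : ∀ k ∈ I, MeasurableSet {y | B k y = s} := fun k hk =>
    (hS k hk).measurable_upper (measurableSet_singleton s)
  have hAs : ∀ k ∈ I, MeasurableSet {y | A k y = s} := fun k hk =>
    (hS k hk).measurable_lower (measurableSet_singleton s)
  have hmB : ∀ k ∈ I, MeasurableSet ({y | B k y = s} ∩ openFibers (Q k) (A k) (B k)) :=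
    fun k hk => (hBs k hk).inter (hS k hk).measurableSet_openFibers
  have hmA : ∀ k ∈ I, MeasurableSet ({y | A k y = s} ∩ openFibers (Q k) (A k) (B k)) :=
    fun k hk => (hAs k hk).inter (hS k hk).measurableSet_openFibers
  have hfO : ∀ k ∈ I, ∀ E, volume (E ∩ openFibers (Q k) (A k) (B k)) < ⊤ := fun k hk E =>
    (measure_mono Set.inter_subset_right).trans_lt
      ((hS k hk).volume_openFibers_lt_top hξ hι (hPb k hk))
  have hjump : ∀ k ∈ I, c k * slabJump (Q k) (A k) (B k) s = ∫ y, c k *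
      (({y | B k y = s} ∩ openFibers (Q k) (A k) (B k)).indicator (fun _ => (1 : ℝ)) y -
        ({y | A k y = s} ∩ openFibers (Q k) (A k) (B k)).indicator (fun _ => (1 : ℝ)) y) := by
    intro k hk
    rw [integral_const_mul, integral_sub (hint (hmB k hk) (hfO k hk _))
      (hint (hmA k hk) (hfO k hk _)), ← hreal (hmB k hk), ← hreal (hmA k hk), slabJump,
      measureReal_restrict_apply (hBs k hk), measureReal_restrict_apply (hAs k hk)]
  have hintk : ∀ k ∈ I, Integrable fun y => c k *
      (({y | B k y = s} ∩ openFibers (Q k) (A k) (B k)).indicator (fun _ => (1 : ℝ)) y -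
        ({y | A k y = s} ∩ openFibers (Q k) (A k) (B k)).indicator (fun _ => (1 : ℝ)) y) :=
    fun k hk => ((hint (hmB k hk) (hfO k hk _)).sub (hint (hmA k hk) (hfO k hk _))).const_mul _
  rw [Finset.sum_congr rfl hjump, ← integral_finsetSum I hintk,
    hreal (hmeas ξ hξ0), hreal (hmeas _ hξ0'),
    ← integral_sub (hint (hmeas ξ hξ0) (hfin ξ)) (hint (hmeas _ hξ0') (hfin _))]
  refine integral_congr_ae ?_
  filter_upwards [ae_isTransverselyGeneric (ι := ι) (ξ := ξ) (H := H) s] with y hy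
  obtain ⟨p, hp, -⟩ := exists_eventually_mem_iff_sign hsurj hy h𝒯
  rw [← hΩ] at hp
  have hplus : y ∈ {y | ι y + s • ξ ∈ pointsWithNormal Ω ξ} ↔ p (-1) ∧ ¬ p 1 :=
    mem_pointsWithNormal_iff hξ hclosed hp
  have hminus : y ∈ {y | ι y + s • ξ ∈ pointsWithNormal Ω (-ξ)} ↔ p 1 ∧ ¬ p (-1) :=
    mem_pointsWithNormal_neg_iff hξ hclosed hp
  -- evaluate both sides just below and just above the height `s`
  have hev := (Filter.eventually_all_finset I).2 fun k hk =>
    (hS k hk).eventually_indicator_sub y s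
  obtain ⟨t, ⟨ht1, ht2⟩, ht3⟩ := (((eventually_sub_smul_mem_iff hξ hp).and
    (eventually_add_smul_mem_iff hξ hp)).and hev).exists
  have hL : Ω.indicator (fun _ => (1 : ℝ)) (ι y + s • ξ - t • ξ) -
      Ω.indicator (fun _ => (1 : ℝ)) (ι y + s • ξ + t • ξ) =
      {y | ι y + s • ξ ∈ pointsWithNormal Ω ξ}.indicator (fun _ => (1 : ℝ)) y -
        {y | ι y + s • ξ ∈ pointsWithNormal Ω (-ξ)}.indicator (fun _ => (1 : ℝ)) y := by
    classical
    simp only [Set.indicator_apply, hplus, hminus, ht1, ht2]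
    by_cases h1 : p 1 <;> by_cases h2 : p (-1) <;> simp [h1, h2]
  rw [← hL, hsum, hsum, ← Finset.sum_sub_distrib]
  refine Finset.sum_congr rfl fun k hk => ?_
  rw [← mul_sub, ht3 k hk]

/-- The transform of a polytope in the direction `ξ`: up to the factor `2 π i τ` it is Lipschitz in the
horizontal variable, uniformly in `τ`, and asymptotic to a trigonometric sum whose coefficients add
up to the signed face area. -/
theorem exists_jump_expansion {Ω : Set (EuclideanSpace ℝ (Fin (n + 1)))} (hΩ : IsPolytope Ω)
    (hξ : ‖ξ‖ = 1) (hι : ∀ y, inner ℝ ξ (ι y) = (0 : ℝ))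
    (hsurj : ∀ x, ∃ y, x = ι y + (inner ℝ ξ x : ℝ) • ξ)
    (hmp : MeasurePreserving (fun p : EuclideanSpace ℝ (Fin n) × ℝ => ι p.1 + p.2 • ξ)) :
    ∃ (S : Finset ℝ) (J : ℝ → ℝ) (C : ℝ), ∑ s ∈ S, J s = signedFaceArea Ω ξ ∧
      (∀ v (τ : ℝ), τ ≠ 0 → ‖2 * Real.pi * Complex.I * τ * expTransform Ω (ι v + τ • ξ) -
        2 * Real.pi * Complex.I * τ * expTransform Ω (τ • ξ)‖ ≤ C * ‖v‖) ∧
      Tendsto (fun τ : ℝ => 2 * Real.pi * Complex.I * τ * expTransform Ω (τ • ξ) -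
        ∑ s ∈ S, (J s : ℂ) * 𝐞 (τ * s)) atTop (𝓝 0) := by
  classical
  obtain ⟨𝒯, R, rfl, h𝒯⟩ := hΩ.exists_polyhedra hξ
  set H := 𝒯.biUnion id with hH
  have hKH : ∀ K ∈ 𝒯, K ⊆ H := fun K hK => Finset.subset_biUnion_of_mem id hK
  set I := 𝒯.powerset.erase ∅ with hI
  set P : Finset (Finset (EuclideanSpace ℝ (Fin (n + 1)) × ℝ)) →
    Set (EuclideanSpace ℝ (Fin (n + 1))) := fun T => polyhedron (T.biUnion id) with hP
  have hmemI : ∀ T ∈ I, T ⊆ 𝒯 ∧ ∃ K, K ∈ T := fun T hT => by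
    rw [hI, Finset.mem_erase, Finset.mem_powerset] at hT
    exact ⟨hT.2, Finset.nonempty_iff_ne_empty.2 hT.1⟩
  have hslab : ∀ T ∈ I, ∃ Q A B, IsSlab ι ξ H (P T) Q A B := fun T hT => by
    obtain ⟨hT𝒯, K, hK⟩ := hmemI T hT
    have hsub := Finset.subset_biUnion_of_mem id hK
    exact exists_isSlab_polyhedron ι hξ (Finset.biUnion_subset_biUnion_of_subset_left id hT𝒯)
      (hsub (h𝒯 K (hT𝒯 hK)).2.1) (hsub (h𝒯 K (hT𝒯 hK)).2.2)
  choose! Q A B hS using hslab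
  have hPb : ∀ T ∈ I, Bornology.IsBounded (P T) := fun T hT => by
    obtain ⟨hT𝒯, K, hK⟩ := hmemI T hT
    exact (h𝒯 K (hT𝒯 hK)).1.subset (polyhedron_anti (Finset.subset_biUnion_of_mem id hK))
  have hPm : ∀ T ∈ I, MeasurableSet (P T) := fun T _ => (isClosed_polyhedron _).measurableSet
  have hΩm : MeasurableSet (⋃ K ∈ 𝒯, polyhedron K) :=
    Finset.measurableSet_biUnion 𝒯 fun K _ => (isClosed_polyhedron K).measurableSet
  have hb : Bornology.IsBounded (⋃ K ∈ 𝒯, polyhedron K) :=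
    (Bornology.isBounded_biUnion (Finset.finite_toSet 𝒯)).2 fun K hK => (h𝒯 K hK).1
  set c : Finset (Finset (EuclideanSpace ℝ (Fin (n + 1)) × ℝ)) → ℝ :=
    fun T => (-1) ^ (T.card + 1) with hc
  have hsum : ∀ x, (⋃ K ∈ 𝒯, polyhedron K).indicator (fun _ => (1 : ℝ)) x =
      ∑ T ∈ I, c T * (P T).indicator (fun _ => (1 : ℝ)) x := indicator_biUnion_polyhedron 𝒯
  have hF := expTransform_eq_sum hΩm hPm (fun T hT => (hPb T hT).measure_lt_top.ne) hsum
  choose! C hC using fun T hT =>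
    (hS T hT).exists_expTransform_lipschitz hξ hι hmp (hPm T hT) (hPb T hT)
  refine ⟨orthogonalLevels ξ H, fun s => ∑ T ∈ I, c T * slabJump (Q T) (A T) (B T) s,
    ∑ T ∈ I, |c T| * C T, ?_, fun v τ hτ => ?_, ?_⟩
  · rw [signedFaceArea_eq_sum_slices hξ hι hsurj hKH hb]
    exact Finset.sum_congr rfl fun s _ =>
      (volume_slices_sub_eq_sum_slabJump hξ hι hsurj hKH hb hS hPb hsum s).symm
  · rw [hF, hF, ← mul_sub, ← Finset.sum_sub_distrib, Finset.mul_sum, Finset.sum_mul]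
    refine (norm_sum_le _ _).trans (Finset.sum_le_sum fun T hT => ?_)
    have heq : 2 * Real.pi * Complex.I * τ * ((c T : ℂ) * expTransform (P T) (ι v + τ • ξ) -
        c T * expTransform (P T) (τ • ξ)) = c T *
        (2 * Real.pi * Complex.I * τ * expTransform (P T) (ι v + τ • ξ) -
          2 * Real.pi * Complex.I * τ * expTransform (P T) (τ • ξ)) := by ring
    rw [heq, norm_mul, Complex.norm_real, Real.norm_eq_abs, mul_assoc |c T|]
    exact mul_le_mul_of_nonneg_left (hC T hT v τ hτ) (abs_nonneg _)
  · have h0 := tendsto_finsetSum I fun T hT =>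
      ((hS T hT).tendsto_expTransform_sub_sum hξ hι hmp (hPm T hT) (hPb T hT)).const_mul (c T : ℂ)
    simp only [mul_zero, Finset.sum_const_zero] at h0
    refine h0.congr fun τ => ?_
    rw [hF, Finset.mul_sum]
    simp only [mul_sub, Finset.sum_sub_distrib, Complex.ofReal_sum, Complex.ofReal_mul,
      Finset.sum_mul]
    congr 1
    · exact Finset.sum_congr rfl fun T _ => by ring
    · simp only [Finset.mul_sum]
      rw [Finset.sum_comm]
      exact Finset.sum_congr rfl fun s _ => Finset.sum_congr rfl fun T _ => by ring

end Jumps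

/-! ### Balls without zeros and conclusion -/

/-- Simultaneous recurrence: the powers of a point of a torus return to every neighbourhood of `1`,
here to one that is small enough for the first `N` powers of its elements. -/
theorem exists_nat_forall_norm_fourierChar_sub_one_lt (S : Finset ℝ) (N : ℕ) {ε : ℝ} (hε : 0 < ε)
    (T : ℝ) : ∃ m : ℕ, T ≤ m ∧ ∀ j ≤ N, ∀ s ∈ S, ‖(𝐞 ((j : ℝ) * m * s) : ℂ) - 1‖ < ε := by
  set x : S → Circle := fun s => 𝐞 (s : ℝ) with hx
  have hU : ∀ᶠ z : S → Circle in 𝓝 1, ∀ j ∈ Finset.range (N + 1), ∀ s : S,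
      ‖((z s ^ j : Circle) : ℂ) - 1‖ < ε := by
    rw [Filter.eventually_all_finset]
    intro j _
    rw [Filter.eventually_all]
    intro s
    have hc : Continuous fun z : S → Circle => ‖((z s ^ j : Circle) : ℂ) - 1‖ := by fun_prop
    refine hc.continuousAt.eventually_lt continuousAt_const ?_
    simpa using hε
  have hfreq := (mapClusterPt_iff_frequently.1 (mapClusterPt_one_atTop_pow x)) _ hU
  obtain ⟨m, hm, hTm⟩ := (hfreq.and_eventually
    (tendsto_natCast_atTop_atTop.eventually_ge_atTop T)).exists
  refine ⟨m, hTm, fun j hj s hs => ?_⟩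
  have := hm j (Finset.mem_range.2 (by omega)) ⟨s, hs⟩
  have heq : 𝐞 ((j : ℝ) * m * s) = (x ^ m) ⟨s, hs⟩ ^ j := by
    rw [Pi.pow_apply, hx, ← pow_mul, ← AddChar.map_nsmul_eq_pow, nsmul_eq_mul]
    push_cast
    ring_nf
  rw [heq]
  exact this

/-- With `v = m ξ` for a large return time `m`, the trigonometric sum is within `a / 2` of its value
at `0`, whose absolute value `a` is not zero, on the balls of radius `2 δ` around `j v`; the errors
from the horizontal displacement and from the asymptotics are at most `a / 4` each. -/
theorem exists_forall_expTransform_ne_zero {n : ℕ} {Ω : Set (EuclideanSpace ℝ (Fin (n + 1)))}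
    (hΩ : IsPolytope Ω) (hvol : volume Ω = 1) {ξ : EuclideanSpace ℝ (Fin (n + 1))}
    (hξ : ‖ξ‖ = 1) (harea : signedFaceArea Ω ξ ≠ 0) :
    ∃ δ > 0, ∀ N : ℕ, ∃ v : EuclideanSpace ℝ (Fin (n + 1)), 2 * δ ≤ ‖v‖ ∧ ∀ j : ℕ, j ≤ N →
      ∀ w, ‖w‖ < 2 * δ → expTransform Ω ((j : ℝ) • v + w) ≠ 0 := by
  obtain ⟨ι, hι, hsurj, hmp⟩ := exists_orthogonal_slicing hξ
  obtain ⟨S, J, C, hJ, hlip, hlim⟩ := exists_jump_expansion hΩ hξ hι hsurj hmp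
  rw [← hJ] at harea
  set a : ℝ := |∑ s ∈ S, J s| with ha
  have ha0 : 0 < a := abs_pos.2 harea
  have hF0 : expTransform Ω 0 ≠ 0 := by simp [expTransform, expFun, Measure.real, hvol]
  obtain ⟨ρ, hρ, hρF⟩ := Metric.eventually_nhds_iff_ball.1
    ((continuous_expTransform (by simp [hvol])).continuousAt.eventually_ne hF0)
  set L : ℝ := ∑ s ∈ S, |J s| with hL
  set M : ℝ := ∑ s ∈ S, |J s| * (2 * Real.pi * |s|) with hM
  have hL0 : 0 ≤ L := Finset.sum_nonneg fun s _ => abs_nonneg _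
  have hM0 : 0 ≤ M := Finset.sum_nonneg fun s _ => by positivity
  obtain ⟨δ, hδ, hδρ, hδC⟩ : ∃ δ > 0, 2 * δ ≤ ρ ∧ (|C| + M) * (2 * δ) ≤ a / 4 := by
    refine ⟨min (ρ / 2) (a / (8 * (|C| + M + 1))), by positivity, ?_, ?_⟩
    · linarith [min_le_left (ρ / 2) (a / (8 * (|C| + M + 1)))]
    · have h1 := min_le_right (ρ / 2) (a / (8 * (|C| + M + 1)))
      have hpos : 0 < |C| + M + 1 := by positivity
      rw [le_div_iff₀ (by positivity)] at h1
      have h2 : 0 ≤ min (ρ / 2) (a / (8 * (|C| + M + 1))) := by positivity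
      nlinarith
  refine ⟨δ, hδ, fun N => ?_⟩
  obtain ⟨T, hT⟩ := eventually_atTop.1
    ((tendsto_zero_iff_norm_tendsto_zero.1 hlim).eventually_lt_const (u := a / 4) (by positivity))
  obtain ⟨m, hm, hmS⟩ := exists_nat_forall_norm_fourierChar_sub_one_lt S N
    (ε := a / (4 * (L + 1))) (by positivity) (max T 1 + 2 * δ)
  have hm1 : T + 2 * δ ≤ m := by linarith [le_max_left T 1]
  have hm2 : 1 + 2 * δ ≤ m := by linarith [le_max_right T 1]
  refine ⟨(m : ℝ) • ξ, ?_, fun j hj w hw => ?_⟩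
  · rw [norm_smul, hξ, Real.norm_natCast]
    linarith
  -- the ball around the origin, where the asymptotics say nothing
  rcases Nat.eq_zero_or_pos j with rfl | hj0
  · rw [Nat.cast_zero, zero_smul, zero_add]
    exact hρF w (mem_ball_zero_iff.2 (hw.trans_le hδρ))
  obtain ⟨y, hy⟩ := hsurj w
  set u : ℝ := inner ℝ ξ w with hu
  have hu2 : |u| < 2 * δ := by
    refine lt_of_le_of_lt ?_ hw
    simpa [hξ] using abs_real_inner_le_norm ξ w
  have hy2 : ‖y‖ ≤ 2 * δ := by
    refine (le_of_sq_le_sq ?_ (norm_nonneg _)).trans hw.le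
    rw [hy, norm_slicing_sq hξ hι]
    nlinarith [sq_nonneg u]
  have hj1 : (1 : ℝ) ≤ j := by exact_mod_cast hj0
  set τ : ℝ := j * m + u with hτ
  have hτm : (m : ℝ) - 2 * δ ≤ τ := by
    have h1 := (abs_lt.1 hu2).1
    have h2 : (m : ℝ) ≤ j * m := le_mul_of_one_le_left (Nat.cast_nonneg m) hj1
    linarith
  have hpoint : (j : ℝ) • (m : ℝ) • ξ + w = ι y + τ • ξ := by
    conv_lhs => rw [hy]
    rw [hτ, add_smul, mul_smul]
    abel
  rw [hpoint]
  intro hzero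
  have h1 := hlip y τ (by linarith)
  rw [hzero, mul_zero, zero_sub, norm_neg] at h1
  have h1' : C * ‖y‖ ≤ |C| * (2 * δ) :=
    mul_le_mul (le_abs_self C) hy2 (norm_nonneg _) (abs_nonneg _)
  have h2 := hT τ (by linarith)
  have h3 : ‖∑ s ∈ S, (J s : ℂ) * 𝐞 (τ * s) - ∑ s ∈ S, (J s : ℂ)‖ ≤
      L * (a / (4 * (L + 1))) + M * (2 * δ) := by
    rw [← Finset.sum_sub_distrib, hL, hM, Finset.sum_mul, Finset.sum_mul,
      ← Finset.sum_add_distrib]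
    refine (norm_sum_le _ _).trans (Finset.sum_le_sum fun s hs => ?_)
    have hfac : (𝐞 (τ * s) : ℂ) - 1 =
        (𝐞 ((j : ℝ) * m * s) : ℂ) * ((𝐞 (u * s) : ℂ) - 1) + ((𝐞 ((j : ℝ) * m * s) : ℂ) - 1) := by
      rw [hτ, add_mul, coe_fourierChar_add]
      ring
    have hb : ‖(𝐞 (τ * s) : ℂ) - 1‖ ≤ 2 * Real.pi * (2 * δ * |s|) + a / (4 * (L + 1)) := by
      rw [hfac]
      refine (norm_add_le _ _).trans (add_le_add ?_ (hmS j hj s hs).le)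
      rw [norm_mul, Circle.norm_coe, one_mul]
      refine (norm_fourierChar_sub_one_le _).trans ?_
      rw [abs_mul]
      gcongr
    calc ‖(J s : ℂ) * 𝐞 (τ * s) - J s‖ = |J s| * ‖(𝐞 (τ * s) : ℂ) - 1‖ := by
          rw [← Real.norm_eq_abs, ← Complex.norm_real, ← norm_mul, mul_sub, mul_one]
      _ ≤ |J s| * (2 * Real.pi * (2 * δ * |s|) + a / (4 * (L + 1))) := by gcongr
      _ = _ := by ring
  have h4 : L * (a / (4 * (L + 1))) ≤ a / 4 := by
    rw [← mul_div_assoc, div_le_div_iff₀ (by positivity) (by positivity)]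
    nlinarith
  have h5 : a = ‖∑ s ∈ S, (J s : ℂ)‖ := by
    rw [ha, ← Complex.ofReal_sum, Complex.norm_real, Real.norm_eq_abs]
  have h6 : ‖∑ s ∈ S, (J s : ℂ)‖ ≤
      ‖∑ s ∈ S, (J s : ℂ) * 𝐞 (τ * s) - ∑ s ∈ S, (J s : ℂ)‖ +
      ‖2 * Real.pi * Complex.I * τ * expTransform Ω (τ • ξ) -
        ∑ s ∈ S, (J s : ℂ) * 𝐞 (τ * s)‖ +
      ‖2 * Real.pi * Complex.I * τ * expTransform Ω (τ • ξ)‖ := by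
    have : ∑ s ∈ S, (J s : ℂ) = 2 * Real.pi * Complex.I * τ * expTransform Ω (τ • ξ) -
        (∑ s ∈ S, (J s : ℂ) * 𝐞 (τ * s) - ∑ s ∈ S, (J s : ℂ)) -
        (2 * Real.pi * Complex.I * τ * expTransform Ω (τ • ξ) -
          ∑ s ∈ S, (J s : ℂ) * 𝐞 (τ * s)) := by ring
    conv_lhs => rw [this]
    refine (norm_sub_le _ _).trans ?_
    linarith [norm_sub_le (2 * Real.pi * Complex.I * τ * expTransform Ω (τ • ξ))
      (∑ s ∈ S, (J s : ℂ) * 𝐞 (τ * s) - ∑ s ∈ S, (J s : ℂ))]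
  rw [← h5] at h6
  linarith

theorem IsPolytope.measurableSet {d : ℕ} {Ω : Set (EuclideanSpace ℝ (Fin d))}
    (hΩ : IsPolytope Ω) : MeasurableSet Ω := by
  obtain ⟨C, hC, hconv, rfl⟩ := hΩ
  refine MeasurableSet.sUnion hC.countable fun P hP => ?_
  obtain ⟨-, -, G, rfl⟩ := hconv P hP
  exact (isClosed_polyhedron G).measurableSet

theorem theorem1 {d : ℕ} (Ω : Set (EuclideanSpace ℝ (Fin d)))
    (hΩ : IsPolytope Ω) (hvol : MeasureTheory.volume Ω = 1)
    (hξ : ∃ ξ : EuclideanSpace ℝ (Fin d), ‖ξ‖ = 1 ∧ signedFaceArea Ω ξ ≠ 0) :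
    ¬ IsSpectral Ω := by
  obtain ⟨ξ, hξ1, harea⟩ := hξ
  rcases d with _ | n
  · rw [Subsingleton.elim ξ 0, norm_zero] at hξ1
    exact absurd hξ1 zero_ne_one
  obtain ⟨δ, hδ, h⟩ := exists_forall_expTransform_ne_zero hΩ hvol hξ1 harea
  rintro ⟨Λ, hΛ⟩
  exact not_isSpectralPair_of_expTransform_ne_zero hΩ.measurableSet hvol hδ h hΛ
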